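/- Let $G=(V,E)$ be a finite undirected graph with edge costs $c:E\to\mathbb{R}_{\ge 0}$, and let $R\subseteq V$ be a set of terminals. For a subtree $T$ of $G$ and $v\in V(T)$ let $p_T(v)=\max_{uv\in E(T)}c(uv)$ (and $p_T(v)=0$ if no edge of $T$ is incident to $v$), and let the power of $T$ be $p(T)=\sum_{v\in V(T)}p_T(v)$. A Steiner tree over $R$ is a subtree $S$ of $G$ with $R\subseteq V(S)$. A $k$-decomposition of $S$ is a finite family $C_1,\dots,C_n$ of (possibly overlapping) subtrees of $S$, each containing at most $k$ terminals, whose union is $S$, and whose component graph is a tree; here the component graph has as nodes the terminals in $R$ and one distinct dummy node $v_{C_i}$ for each $i$, and its edges join $v_{C_i}$ to every terminal contained in $C_i$, for each $i$. The power of the decomposition is $\sum_{i=1}^n p(C_i)$. Theorem (Decomposition). For every integer $h\ge 3$ and every Steiner tree $S$ over $R$ there is an $h^h$-decomposition of $S$ of power at most $\left(1+\frac{14}{h}\right)p(S)$. -/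

import Mathlib

open scoped NNReal

namespace MinPower

variable {V : Type*} [Fintype V] {G : SimpleGraph V}

/-- `S` is a Steiner tree of `G` over the terminals `R`: a subtree of `G` containing all nodes
of `R`. Leaves of `S` need not be terminals. -/
structure IsSteinerTree (R : Set V) (S : G.Subgraph) : Prop where
  isTree : S.coe.IsTree
  terminals_subset : R ⊆ S.verts

open Classical in
/-- The power of the node `v` with respect to the subgraph `H`: the largest cost of an edge of `H`
incident to `v` (it is `0` if there is no such edge). -/
noncomputable def nodePower (c : Sym2 V → ℝ≥0) (H : G.Subgraph) (v : V) : ℝ≥0 :=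
  (Finset.univ.filter fun u => H.Adj v u).sup fun u => c s(v, u)

open Classical in
/-- The power of the subgraph `H`: the sum of the powers of its nodes. -/
noncomputable def power (c : Sym2 V → ℝ≥0) (H : G.Subgraph) : ℝ≥0 :=
  ∑ v ∈ Finset.univ.filter (fun v => v ∈ H.verts), nodePower c H v

/-- The component graph of a family `C` of subgraphs: its nodes are the terminals together with
one distinct dummy node for each member of the family, and the dummy node of `C i` is joined
exactly to the terminals contained in `C i`. -/
def componentGraph (R : Set V) {ι : Type*} (C : ι → G.Subgraph) : SimpleGraph (R ⊕ ι) where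
  Adj
    | .inl t, .inr i => (t : V) ∈ (C i).verts
    | .inr i, .inl t => (t : V) ∈ (C i).verts
    | _, _ => False
  symm := ⟨by rintro (t | i) (s | j) h <;> exact h⟩
  loopless := ⟨by rintro (t | i) h <;> exact h⟩

/-- The family `C` is a `k`-decomposition of the Steiner tree `S` over the terminals `R`. Members
may overlap, and may share edges. -/
structure IsDecomposition (R : Set V) (S : G.Subgraph) (k : ℕ) {ι : Type*}
    (C : ι → G.Subgraph) : Prop where
  /-- every component is a subgraph of `S` -/
  le : ∀ i, C i ≤ S
  /-- every component is a tree -/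
  isTree : ∀ i, (C i).coe.IsTree
  /-- every component contains at most `k` terminals -/
  card_terminals_le : ∀ i, (R ∩ (C i).verts).ncard ≤ k
  /-- the components together span `S` -/
  span : ⨆ i, C i = S
  /-- the component graph is a tree -/
  componentGraph_isTree : (componentGraph R C).IsTree

end MinPower

/-!
Root the Steiner tree `S` at any node and write `p(x)` for the power of `x` in `S`. Decompositions
of the branches of `S` are built from the leaves up. Each one has an *open* root component containing
the root of the branch, which may still grow at the next step, and all other components are closed.

Two operations create more than one component. At a node `v` with many children the branches are
put into chunks of `h - 2`, in the order of decreasing cost of the edges at `v`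
(`HasDec.glue_fan`, `HasDec.of_fan`). The first chunk, which may have one more branch, belongs to
the root component; the root
component of every later chunk is closed and joined, by a connector running from `v` through one
branch of the preceding chunk, to a single terminal there. So the component graph gains one edge
between two trees (`componentGraph_glueFamily_isTree`). Secondly, after `h` levels of branching
nodes or terminals the root component is closed, and a connector to a single terminal takes its
place (`HasDec.cut`). In between, the root component gains a factor of at most `h` in its number of
terminals per level, so no component has more than `h ^ h` terminals. Branches without terminals are
never split, they simply join the root component.

The cost is controlled as follows. Every node `x` pays `p(x)` in one component, and the rest is
excess. If `W u` bounds the power of a connector from `u` downwards, then a connector from `v`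
through a child `u` costs at most `2 * W u`, the power of `v` included, and this also bounds the
power of `v` in the next chunk because of the order of the chunks. The cheapest child of a chunk has
at most the average `W`, so chunks cause an excess of at most `2 / (h - 2)` times the sum of `W u`
over the children, one of which can be left out: through that child runs the connector of `v`, so
that `W v = p(v) + W u`. Cuts only happen for one of `h` possible offsets of the levels. Hence the
excess summed over all `h` offsets is at most `7` times the sum of `W u` over the children that were
not left out, plus terms `p(v)`. Since each `W u` is spent once, or is passed on to `v` and enlarged
by `p(v)`, a budget of `8 * p(x)` for every node `x` suffices (`IsLive.budget`, `isLive_of_fan`),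
and the best offset has excess at most `(8 / h) * p(S)`.
-/

namespace MinPower

variable {V : Type*} {G : SimpleGraph V}

/-! ### The component graph -/

/-- The edges of the component graph are the pairs of a component and a terminal in it, so being a
tree is connectedness together with a count of these incidences. -/
lemma componentGraph_isTree_iff [Fintype V] (R : Set V) {ι : Type*} [Fintype ι] (C : ι → G.Subgraph) :
    (componentGraph R C).IsTree ↔ (componentGraph R C).Connected ∧
      ∑ i, (R ∩ (C i).verts).ncard + 1 = R.ncard + Fintype.card ι := by
  classical
  have hcard : Nat.card (componentGraph R C).edgeSet = ∑ i, (R ∩ (C i).verts).ncard := by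
    have : Nat.card (Σ i, ↥(R ∩ (C i).verts)) = ∑ i, (R ∩ (C i).verts).ncard := by
      rw [Nat.card_sigma]; rfl
    rw [← this]
    symm
    refine Nat.card_congr (Equiv.ofBijective
      (fun p => ⟨s(Sum.inl ⟨p.2.1, p.2.2.1⟩, Sum.inr p.1), p.2.2.2⟩) ⟨?_, ?_⟩)
    · rintro ⟨i, t, ht⟩ ⟨j, t', ht'⟩ h
      rcases Sym2.eq_iff.1 (congrArg Subtype.val h) with ⟨h1, h2⟩ | ⟨h1, h2⟩
      · simp only [Sum.inl.injEq, Sum.inr.injEq, Subtype.mk.injEq] at h1 h2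
        subst h1 h2
        rfl
      · simp at h1
    · rintro ⟨e, he⟩
      induction e using Sym2.ind with
      | _ x y =>
        rcases x with t | i <;> rcases y with s | j
        · exact he.elim
        · exact ⟨⟨j, t.1, t.2, he⟩, rfl⟩
        · exact ⟨⟨i, s.1, s.2, he⟩, Subtype.ext Sym2.eq_swap⟩
        · exact he.elim
  rw [SimpleGraph.isTree_iff_connected_and_card, hcard, Nat.card_sum, Nat.card_coe_set_eq,
    Nat.card_eq_fintype_card]

/-- A component graph is connected as soon as it is covered by the images of two connected component
graphs with a link between them. -/
lemma componentGraph_connected_of_cover {R R₁ R₂ : Set V} {κ α β : Type*} {C : κ → G.Subgraph}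
    {A : α → G.Subgraph} {B : β → G.Subgraph} (φ : α → κ) (ψ : β → κ)
    (hA : (componentGraph R₁ A).Connected) (hB : (componentGraph R₂ B).Connected)
    (h₁ : R₁ ⊆ R) (h₂ : R₂ ⊆ R) (hR : R ⊆ R₁ ∪ R₂)
    (hφ : ∀ i, A i ≤ C (φ i)) (hψ : ∀ i, B i ≤ C (ψ i))
    (hκ : ∀ k, (∃ i, φ i = k) ∨ ∃ j, ψ j = k) (x : R₁ ⊕ α) (y : R₂ ⊕ β)
    (hxy : (componentGraph R C).Reachable (Sum.map (Set.inclusion h₁) φ x)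
      (Sum.map (Set.inclusion h₂) ψ y)) :
    (componentGraph R C).Connected := by
  let f : componentGraph R₁ A →g componentGraph R C :=
    ⟨Sum.map (Set.inclusion h₁) φ, by
      rintro (t | i) (s | j) h
      · exact h.elim
      · exact (hφ j).1 h
      · exact (hφ i).1 h
      · exact h.elim⟩
  let g : componentGraph R₂ B →g componentGraph R C :=
    ⟨Sum.map (Set.inclusion h₂) ψ, by
      rintro (t | i) (s | j) h
      · exact h.elim
      · exact (hψ j).1 h
      · exact (hψ i).1 h
      · exact h.elim⟩
  have hf : ∀ z, (componentGraph R C).Reachable (f x) (f z) := fun z =>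
    (hA.preconnected x z).map f
  have hg : ∀ z, (componentGraph R C).Reachable (f x) (g z) := fun z =>
    hxy.trans ((hB.preconnected y z).map g)
  rw [SimpleGraph.connected_iff_exists_forall_reachable]
  refine ⟨f x, ?_⟩
  rintro (⟨t, ht⟩ | k)
  · rcases hR ht with h | h
    · exact hf (.inl ⟨t, h⟩)
    · exact hg (.inl ⟨t, h⟩)
  · rcases hκ k with ⟨i, rfl⟩ | ⟨j, rfl⟩
    · exact hf (.inr i)
    · exact hg (.inr j)

/-- A single component containing all terminals gives a star. -/
lemma componentGraph_isTree_of_unique [Fintype V] {R : Set V} {ι : Type*} [Fintype ι] [Unique ι]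
    {C : ι → G.Subgraph} (hR : R ⊆ (C default).verts) : (componentGraph R C).IsTree := by
  rw [componentGraph_isTree_iff]
  constructor
  · rw [SimpleGraph.connected_iff_exists_forall_reachable]
    refine ⟨.inr default, ?_⟩
    rintro (t | k)
    · exact SimpleGraph.Adj.reachable (show (t : V) ∈ (C default).verts from hR t.2)
    · rw [Unique.eq_default k]
  · rw [Fintype.sum_unique, Set.inter_eq_left.2 hR, Fintype.card_unique]

/-- The family obtained from `A` and `B` by replacing the two root components by `O`. -/
def mergeFamily {ι κ : Type*} (O : G.Subgraph) (A : Option ι → G.Subgraph)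
    (B : Option κ → G.Subgraph) : Option (ι ⊕ κ) → G.Subgraph
  | none => O
  | some (.inl i) => A (some i)
  | some (.inr j) => B (some j)

/-- The family obtained from `A` and `B` by enlarging the root component of `B` by `P`; the root
component is that of `A`. -/
def glueFamily {ι κ : Type*} (P : G.Subgraph) (A : Option ι → G.Subgraph)
    (B : Option κ → G.Subgraph) : Option (ι ⊕ Option κ) → G.Subgraph
  | none => A none
  | some (.inl i) => A (some i)
  | some (.inr none) => B none ⊔ P
  | some (.inr (some j)) => B (some j)

/-- The family `A` together with a new root component `P`. -/
def consFamily {ι : Type*} (P : G.Subgraph) (A : ι → G.Subgraph) : Option ι → G.Subgraph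
  | none => P
  | some i => A i

lemma ncard_union_inter_of_left {R₁ R₂ s : Set V} (h : ∀ x ∈ R₂, x ∉ s) :
    ((R₁ ∪ R₂) ∩ s).ncard = (R₁ ∩ s).ncard := by
  congr 1; ext x; simp only [Set.mem_inter_iff, Set.mem_union]; grind

lemma ncard_union_inter_of_right {R₁ R₂ s : Set V} (h : ∀ x ∈ R₁, x ∉ s) :
    ((R₁ ∪ R₂) ∩ s).ncard = (R₂ ∩ s).ncard := by
  rw [Set.union_comm, ncard_union_inter_of_left h]

/-- Identifying one dummy node of each of two component graphs with disjoint terminals turns two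
trees into a tree. -/
lemma componentGraph_mergeFamily_isTree [Fintype V] {R₁ R₂ : Set V} {ι κ : Type*} [Fintype ι] [Fintype κ]
    {O : G.Subgraph} {A : Option ι → G.Subgraph} {B : Option κ → G.Subgraph}
    (hA : (componentGraph R₁ A).IsTree) (hB : (componentGraph R₂ B).IsTree)
    (hAO : A none ≤ O) (hBO : B none ≤ O)
    (hO : (R₁ ∪ R₂) ∩ O.verts ⊆ (A none).verts ∪ (B none).verts)
    (h₁ : ∀ j, ∀ x ∈ R₁, x ∉ (B j).verts) (h₂ : ∀ i, ∀ x ∈ R₂, x ∉ (A i).verts)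
    (hR : Disjoint R₁ R₂) :
    (componentGraph (R₁ ∪ R₂) (mergeFamily O A B)).IsTree := by
  classical
  rw [componentGraph_isTree_iff] at hA hB ⊢
  constructor
  · refine componentGraph_connected_of_cover (Option.map Sum.inl) (Option.map Sum.inr) hA.1 hB.1
      Set.subset_union_left Set.subset_union_right subset_rfl ?_ ?_ ?_ (.inr none) (.inr none)
      (SimpleGraph.Reachable.refl _)
    · rintro (_ | i)
      · exact hAO
      · exact le_rfl
    · rintro (_ | i)
      · exact hBO
      · exact le_rfl
    · rintro (_ | i | j)
      · exact .inl ⟨none, rfl⟩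
      · exact .inl ⟨some i, rfl⟩
      · exact .inr ⟨some j, rfl⟩
  · have h0 : ((R₁ ∪ R₂) ∩ O.verts).ncard
        = (R₁ ∩ (A none).verts).ncard + (R₂ ∩ (B none).verts).ncard := by
      rw [← Set.ncard_union_eq (hR.mono Set.inter_subset_left Set.inter_subset_left)]
      congr 1
      ext x
      have h1 := h₁ none x
      have h2 := h₂ none x
      have h3 := @hO x
      have h4 := @hAO.1 x
      have h5 := @hBO.1 x
      simp only [Set.mem_inter_iff, Set.mem_union] at *
      grind
    have hA2 := hA.2
    have hB2 := hB.2
    simp only [Fintype.sum_option, Fintype.sum_sum_type, Fintype.card_option, Fintype.card_sum,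
      mergeFamily, h0] at hA2 hB2 ⊢
    rw [Set.ncard_union_eq hR]
    have e1 : ∀ i, ((R₁ ∪ R₂) ∩ (A (some i)).verts).ncard = (R₁ ∩ (A (some i)).verts).ncard :=
      fun i => ncard_union_inter_of_left (h₂ _)
    have e2 : ∀ i, ((R₁ ∪ R₂) ∩ (B (some i)).verts).ncard = (R₂ ∩ (B (some i)).verts).ncard :=
      fun i => ncard_union_inter_of_right (h₁ _)
    simp only [e1, e2]
    omega

/-- Joining two component graphs with disjoint terminals by a single new edge, between a terminal
`t` of the first and the root component of the second, turns two trees into a tree. -/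
lemma componentGraph_glueFamily_isTree [Fintype V] {R₁ R₂ : Set V} {ι κ : Type*} [Fintype ι] [Fintype κ]
    {P : G.Subgraph} {A : Option ι → G.Subgraph} {B : Option κ → G.Subgraph} {t : V}
    (hA : (componentGraph R₁ A).IsTree) (hB : (componentGraph R₂ B).IsTree)
    (hP : (R₁ ∪ R₂) ∩ P.verts = {t}) (ht : t ∈ R₁)
    (h₁ : ∀ x ∈ R₁, x ∈ (B none).verts → x = t) (h₁' : ∀ j, ∀ x ∈ R₁, x ∉ (B (some j)).verts)
    (h₂ : ∀ i, ∀ x ∈ R₂, x ∉ (A i).verts) (hR : Disjoint R₁ R₂) :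
    (componentGraph (R₁ ∪ R₂) (glueFamily P A B)).IsTree := by
  classical
  have htP : t ∈ P.verts := (hP.ge rfl).2
  have htR : t ∉ R₂ := Set.disjoint_left.1 hR ht
  rw [componentGraph_isTree_iff] at hA hB ⊢
  constructor
  · refine componentGraph_connected_of_cover (Option.map Sum.inl) (fun j => some (.inr j)) hA.1 hB.1
      Set.subset_union_left Set.subset_union_right subset_rfl ?_ ?_ ?_ (.inl ⟨t, ht⟩) (.inr none)
      (SimpleGraph.Adj.reachable ?_)
    · rintro (_ | i) <;> exact le_rfl
    · rintro (_ | i)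
      · exact le_sup_left
      · exact le_rfl
    · rintro (_ | i | j)
      · exact .inl ⟨none, rfl⟩
      · exact .inl ⟨some i, rfl⟩
      · exact .inr ⟨j, rfl⟩
    · exact Or.inr htP
  · have h0 : ((R₁ ∪ R₂) ∩ (B none ⊔ P).verts).ncard = (R₂ ∩ (B none).verts).ncard + 1 := by
      rw [← Set.ncard_singleton t, ← Set.ncard_union_eq
        (Set.disjoint_singleton_right.2 fun h => htR h.1)]
      congr 1
      ext x
      have h1 := h₁ x
      have h3 : x ∈ (R₁ ∪ R₂) ∩ P.verts ↔ x = t := by rw [hP]; rfl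
      simp only [Set.mem_inter_iff, Set.mem_union, SimpleGraph.Subgraph.verts_sup,
        Set.mem_singleton_iff] at *
      grind
    have hA2 := hA.2
    have hB2 := hB.2
    simp only [Fintype.sum_option, Fintype.sum_sum_type, Fintype.card_option, Fintype.card_sum,
      glueFamily, h0] at hA2 hB2 ⊢
    rw [Set.ncard_union_eq hR]
    have e1 : ∀ i, ((R₁ ∪ R₂) ∩ (A i).verts).ncard = (R₁ ∩ (A i).verts).ncard :=
      fun i => ncard_union_inter_of_left (h₂ _)
    have e2 : ∀ i, ((R₁ ∪ R₂) ∩ (B (some i)).verts).ncard = (R₂ ∩ (B (some i)).verts).ncard :=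
      fun i => ncard_union_inter_of_right (h₁' _)
    simp only [e1, e2]
    omega

/-- A new component containing exactly one terminal is a new leaf of the component graph. -/
lemma componentGraph_consFamily_isTree [Fintype V] {R : Set V} {ι : Type*} [Fintype ι]
    {P : G.Subgraph} {A : ι → G.Subgraph} {t : V}
    (hA : (componentGraph R A).IsTree) (hP : R ∩ P.verts = {t}) :
    (componentGraph R (consFamily P A)).IsTree := by
  classical
  have ht : t ∈ R ∩ P.verts := hP.ge rfl
  rw [componentGraph_isTree_iff] at hA ⊢
  constructor
  · have hB := (componentGraph_isTree_of_unique (R := R ∩ P.verts) (ι := Unit) (C := fun _ => P)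
      Set.inter_subset_right).connected
    refine componentGraph_connected_of_cover some (fun _ => none) hA.1 hB
      subset_rfl Set.inter_subset_left Set.subset_union_left (fun _ => le_rfl) (fun _ => le_rfl)
      ?_ (.inl ⟨t, ht.1⟩) (.inl ⟨t, ht⟩) (SimpleGraph.Reachable.refl _)
    rintro (_ | i)
    · exact .inr ⟨(), rfl⟩
    · exact .inl ⟨i, rfl⟩
  · have hA2 := hA.2
    simp only [Fintype.sum_option, Fintype.card_option, consFamily, hP, Set.ncard_singleton]
    omega

/-- The component graph does not depend on the names of the components. -/
lemma componentGraph_comp_equiv_isTree {R : Set V} {ι κ : Type*}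
    {A : ι → G.Subgraph} (e : κ ≃ ι) (hA : (componentGraph R A).IsTree) :
    (componentGraph R (A ∘ e)).IsTree := by
  refine (SimpleGraph.Iso.isTree_iff
    (⟨Equiv.sumCongr (Equiv.refl _) e, ?_⟩ : componentGraph R (A ∘ e) ≃g componentGraph R A)).2 hA
  rintro (t | i) (s | j) <;> exact Iff.rfl

end MinPower

namespace MinPower

variable {V : Type*} {G : SimpleGraph V}

/-! ### Powers of nodes and subgraphs -/

section Power

variable [Fintype V]

lemma le_nodePower (c : Sym2 V → ℝ≥0) {H : G.Subgraph} {v u : V} (h : H.Adj v u) :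
    c s(v, u) ≤ nodePower c H v := by
  classical
  exact Finset.le_sup (f := fun u => c s(v, u)) (by simpa using h)

lemma nodePower_le {c : Sym2 V → ℝ≥0} {H : G.Subgraph} {v : V} {b : ℝ≥0}
    (h : ∀ u, H.Adj v u → c s(v, u) ≤ b) : nodePower c H v ≤ b := by
  classical
  exact Finset.sup_le fun u hu => h u (by simpa using hu)

lemma nodePower_mono (c : Sym2 V → ℝ≥0) {H K : G.Subgraph} (h : H ≤ K) (v : V) :
    nodePower c H v ≤ nodePower c K v :=
  nodePower_le fun _ hu => le_nodePower c (h.2 hu)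

lemma nodePower_sup_le (c : Sym2 V → ℝ≥0) (H K : G.Subgraph) (v : V) :
    nodePower c (H ⊔ K) v ≤ max (nodePower c H v) (nodePower c K v) :=
  nodePower_le fun _ hu => hu.elim (fun h => (le_nodePower c h).trans (le_max_left _ _))
    fun h => (le_nodePower c h).trans (le_max_right _ _)

lemma nodePower_eq_zero (c : Sym2 V → ℝ≥0) {H : G.Subgraph} {v : V} (h : ∀ u, ¬H.Adj v u) :
    nodePower c H v = 0 :=
  le_antisymm (nodePower_le fun u hu => (h u hu).elim) zero_le

open Classical in
/-- The sum of the powers with respect to `H` of all nodes but `v`. -/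
noncomputable def outerPower (c : Sym2 V → ℝ≥0) (H : G.Subgraph) (v : V) : ℝ≥0 :=
  ∑ x ∈ Finset.univ.erase v, nodePower c H x

open Classical in
/-- The sum over the nodes `x` of `T` of the power of `x` with respect to `S` (not to `T`). -/
noncomputable def powerOn (c : Sym2 V → ℝ≥0) (S T : G.Subgraph) : ℝ≥0 :=
  ∑ x ∈ Finset.univ.filter (fun x => x ∈ T.verts), nodePower c S x

lemma powerOn_self (c : Sym2 V → ℝ≥0) (S : G.Subgraph) : powerOn c S S = power c S := rfl

lemma power_eq_add_outerPower (c : Sym2 V → ℝ≥0) (H : G.Subgraph) (v : V) :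
    power c H = nodePower c H v + outerPower c H v := by
  classical
  rw [outerPower, Finset.add_sum_erase _ _ (Finset.mem_univ v), power]
  refine Finset.sum_subset (Finset.subset_univ _) fun x _ hx => nodePower_eq_zero c fun u hu => hx ?_
  simpa using hu.fst_mem

lemma outerPower_sup_le (c : Sym2 V → ℝ≥0) (H K : G.Subgraph) (v : V) :
    outerPower c (H ⊔ K) v ≤ outerPower c H v + outerPower c K v := by
  classical
  rw [outerPower, outerPower, outerPower, ← Finset.sum_add_distrib]
  exact Finset.sum_le_sum fun x _ => (nodePower_sup_le c H K x).trans
    (max_le_add_of_nonneg zero_le zero_le)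

lemma nodePower_le_powerOn (c : Sym2 V → ℝ≥0) (S : G.Subgraph) {T : G.Subgraph} {v : V}
    (hv : v ∈ T.verts) : nodePower c S v ≤ powerOn c S T := by
  classical
  exact Finset.single_le_sum (f := nodePower c S) (fun _ _ => zero_le) (by simpa using hv)

lemma powerOn_sup_of_disjoint (c : Sym2 V → ℝ≥0) (S : G.Subgraph) {T T' : G.Subgraph}
    (h : Disjoint T.verts T'.verts) :
    powerOn c S (T ⊔ T') = powerOn c S T + powerOn c S T' := by
  classical
  rw [powerOn, powerOn, powerOn, ← Finset.sum_union]
  · congr 1; ext x; simp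
  · rw [Finset.disjoint_left]
    intro x hx hx'
    simp only [Finset.mem_filter, Finset.mem_univ, true_and] at hx hx'
    exact Set.disjoint_left.1 h hx hx'

lemma powerOn_congr (c : Sym2 V → ℝ≥0) (S : G.Subgraph) {T T' : G.Subgraph}
    (h : T.verts = T'.verts) : powerOn c S T = powerOn c S T' := by
  unfold powerOn
  congr 1
  ext x
  simp [h]

end Power

/-- The subgraph with the nodes `v` and `u` and, if these are adjacent, the edge between them. -/
def link (G : SimpleGraph V) (v u : V) : G.Subgraph := (⊤ : G.Subgraph).induce {v, u}

lemma link_adj {v u x y : V} :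
    (link G v u).Adj x y ↔ G.Adj x y ∧ (x = v ∧ y = u ∨ x = u ∧ y = v) := by
  simp only [link, SimpleGraph.Subgraph.induce_adj, Set.mem_insert_iff, Set.mem_singleton_iff,
    SimpleGraph.Subgraph.top_adj]
  constructor
  · rintro ⟨rfl | rfl, rfl | rfl, h⟩ <;> simp_all
  · rintro ⟨h, ⟨rfl, rfl⟩ | ⟨rfl, rfl⟩⟩ <;> simp_all

lemma mem_link {v u x : V} : x ∈ (link G v u).verts ↔ x = v ∨ x = u := Iff.rfl

lemma link_connected {v u : V} (h : G.Adj v u) : (link G v u).Connected :=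
  SimpleGraph.Subgraph.top_induce_pair_connected_of_adj h

lemma link_le {S : G.Subgraph} {v u : V} (h : S.Adj v u) : link G v u ≤ S := by
  constructor
  · rintro x (rfl | rfl)
    · exact h.fst_mem
    · exact h.snd_mem
  · intro x y hxy
    rcases (link_adj.1 hxy).2 with ⟨rfl, rfl⟩ | ⟨rfl, rfl⟩
    · exact h
    · exact h.symm

lemma Connected.sup_of_mem {H K : G.Subgraph} (hH : H.Connected) (hK : K.Connected) {v : V}
    (h₁ : v ∈ H.verts) (h₂ : v ∈ K.verts) : (H ⊔ K).Connected :=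
  SimpleGraph.Subgraph.connected_sup hH.preconnected hK.preconnected ⟨v, h₁, h₂⟩

/-- Attaching `T` to `v` by the edge from `v` to its node `u`. -/
lemma Connected.link_sup {T : G.Subgraph} (hT : T.Connected) {v u : V} (h : G.Adj v u)
    (hu : u ∈ T.verts) : (link G v u ⊔ T).Connected :=
  Connected.sup_of_mem (link_connected h) hT (.inr rfl) hu

lemma outerPower_link_sup_le [Fintype V] (c : Sym2 V → ℝ≥0) {S T : G.Subgraph} (hT : T ≤ S)
    {v u : V} (h : S.Adj v u) :
    outerPower c (link G v u ⊔ T) v ≤ nodePower c S u + outerPower c T u := by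
  classical
  have h1 : outerPower c (link G v u ⊔ T) v ≤
      ∑ x, if x = u then nodePower c S u else nodePower c T x := by
    rw [outerPower]
    refine le_trans (Finset.sum_le_sum fun x hx => ?_)
      (Finset.sum_le_sum_of_subset (Finset.subset_univ _))
    rw [Finset.mem_erase] at hx
    split_ifs with hxu
    · subst hxu
      exact nodePower_mono c (sup_le (link_le h) hT) x
    · refine nodePower_le fun y hy => ?_
      rcases hy with hy | hy
      · rcases (link_adj.1 hy).2 with ⟨hx1, -⟩ | ⟨hx1, -⟩
        · exact (hx.1 hx1).elim
        · exact (hxu hx1).elim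
      · exact le_nodePower c hy
  refine h1.trans (le_of_eq ?_)
  rw [← Finset.add_sum_erase _ _ (Finset.mem_univ u), if_pos rfl, outerPower]
  congr 1
  exact Finset.sum_congr rfl fun x hx => if_neg (Finset.mem_erase.1 hx).1

lemma outerPower_le_powerOn [Fintype V] (c : Sym2 V → ℝ≥0) {S T : G.Subgraph} (h : T ≤ S) {v : V}
    (hv : v ∈ T.verts) : nodePower c S v + outerPower c T v ≤ powerOn c S T := by
  classical
  rw [powerOn, ← Finset.add_sum_erase _ _ (show v ∈ Finset.univ.filter (· ∈ T.verts) by simpa)]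
  gcongr
  rw [outerPower]
  refine le_trans (le_of_eq ?_) (Finset.sum_le_sum fun x _ => nodePower_mono c h x)
  symm
  refine Finset.sum_subset (Finset.erase_subset_erase _ (Finset.subset_univ _)) fun x hx hx' =>
    nodePower_eq_zero c fun y hy => hx' ?_
  simpa using ⟨(Finset.mem_erase.1 hx).1, hy.fst_mem⟩

lemma powerOn_sup_link_sup [Fintype V] (c : Sym2 V → ℝ≥0) (S : G.Subgraph) {T T' : G.Subgraph}
    (h : Disjoint T.verts T'.verts) {v u : V} (hv : v ∈ T.verts) (hu : u ∈ T'.verts) :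
    powerOn c S (T ⊔ (link G v u ⊔ T')) = powerOn c S T + powerOn c S T' := by
  rw [← powerOn_sup_of_disjoint c S h]
  refine powerOn_congr c S (Set.ext fun x => ?_)
  simp only [SimpleGraph.Subgraph.verts_sup, Set.mem_union, mem_link]
  grind

end MinPower

namespace MinPower

variable {V : Type*} {G : SimpleGraph V}

/-! ### Decompositions with an open root component -/

/-- `C` is a decomposition of the subtree `T` with root `v` over the terminals `R`, in which the
root component `C none` contains `v` and is still going to be enlarged. Closed components have at
most `k` terminals, the root component at most `N`. The number `a` bounds the power of all closed
components together with the powers in the root component of all nodes but `v`. -/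
structure IsRootedDec [Fintype V] (c : Sym2 V → ℝ≥0) (R : Set V) (k : ℕ) (T : G.Subgraph) (v : V)
    (N : ℕ) (a : ℝ≥0) {ι : Type*} [Fintype ι] (C : Option ι → G.Subgraph) : Prop where
  connected : ∀ i, (C i).Connected
  span : ⨆ i, C i = T
  tree : (componentGraph R C).IsTree
  root_mem : v ∈ (C none).verts
  card_root_le : (R ∩ (C none).verts).ncard ≤ N
  card_le : ∀ i, (R ∩ (C (some i)).verts).ncard ≤ k
  cost_le : ∑ i, power c (C (some i)) + outerPower c (C none) v ≤ a

/-- Existence of a decomposition with an open root component. -/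
def HasDec [Fintype V] (c : Sym2 V → ℝ≥0) (R : Set V) (k : ℕ) (T : G.Subgraph) (v : V)
    (N : ℕ) (a : ℝ≥0) : Prop :=
  ∃ (ι : Type) (_ : Fintype ι) (C : Option ι → G.Subgraph), IsRootedDec c R k T v N a C

/-- Existence of a decomposition with an open root component that is the only component containing
the root. -/
def HasStarDec [Fintype V] (c : Sym2 V → ℝ≥0) (R : Set V) (k : ℕ) (T : G.Subgraph) (v : V)
    (N : ℕ) (a : ℝ≥0) : Prop :=
  ∃ (ι : Type) (_ : Fintype ι) (C : Option ι → G.Subgraph),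
    IsRootedDec c R k T v N a C ∧ ∀ i, v ∉ (C (some i)).verts

variable [Fintype V] {c : Sym2 V → ℝ≥0} {k : ℕ}

lemma IsRootedDec.le {R : Set V} {T : G.Subgraph} {v : V} {N : ℕ} {a : ℝ≥0} {ι : Type*} [Fintype ι]
    {C : Option ι → G.Subgraph} (h : IsRootedDec c R k T v N a C) (i : Option ι) : C i ≤ T :=
  h.span ▸ le_iSup C i

lemma HasStarDec.hasDec {R : Set V} {T : G.Subgraph} {v : V} {N : ℕ} {a : ℝ≥0}
    (h : HasStarDec c R k T v N a) : HasDec c R k T v N a := by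
  obtain ⟨ι, i, C, hC, -⟩ := h
  exact ⟨ι, i, C, hC⟩

lemma HasDec.mono {R : Set V} {T : G.Subgraph} {v : V} {N N' : ℕ} {a a' : ℝ≥0}
    (h : HasDec c R k T v N a) (hN : N ≤ N') (ha : a ≤ a') : HasDec c R k T v N' a' := by
  obtain ⟨ι, i, C, hC⟩ := h
  exact ⟨ι, i, C, { hC with
    card_root_le := hC.card_root_le.trans hN
    cost_le := hC.cost_le.trans ha }⟩

lemma HasStarDec.single {R : Set V} {B : G.Subgraph} {v : V} (hB : B.Connected)
    (hv : v ∈ B.verts) (hR : R ⊆ B.verts) :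
    HasStarDec c R k B v R.ncard (outerPower c B v) :=
  ⟨Empty, inferInstance, fun _ => B,
    { connected := fun _ => hB
      span := by simp
      tree := componentGraph_isTree_of_unique (ι := Option Empty) hR
      root_mem := hv
      card_root_le := by rw [Set.inter_eq_left.2 hR]
      card_le := fun i => i.elim
      cost_le := by simp }, fun i => i.elim⟩

/-- The subtree with root `u` is attached to `v`, merging the root components. In the power of the
root component, `u` now counts with at most its power in the whole tree `S`. -/
lemma HasStarDec.merge {S T₁ T₂ : G.Subgraph} {R₁ R₂ : Set V} {v u : V} {N₁ N₂ : ℕ} {a₁ a₂ : ℝ≥0}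
    (h₁ : HasStarDec c R₁ k T₁ v N₁ a₁) (h₂ : HasDec c R₂ k T₂ u N₂ a₂)
    (hvu : S.Adj v u) (hS : T₂ ≤ S) (hT : Disjoint T₁.verts T₂.verts)
    (hR₁ : R₁ ⊆ T₁.verts) (hR₂ : R₂ ⊆ T₂.verts) :
    HasStarDec c (R₁ ∪ R₂) k (T₁ ⊔ (link G v u ⊔ T₂)) v (N₁ + N₂)
      (a₁ + (nodePower c S u + a₂)) := by
  obtain ⟨ι, _, A, hA, hA'⟩ := h₁
  obtain ⟨κ, _, B, hB⟩ := h₂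
  have hT' := Set.disjoint_left.1 hT
  have d₁ : ∀ j, ∀ x ∈ R₁, x ∉ (B j).verts := fun j x hx hx' => hT' (hR₁ hx) ((hB.le j).1 hx')
  have d₂ : ∀ i, ∀ x ∈ R₂, x ∉ (A i).verts := fun i x hx hx' => hT' ((hA.le i).1 hx') (hR₂ hx)
  set O : G.Subgraph := A none ⊔ (link G v u ⊔ B none) with hOdef
  have hOv : (R₁ ∪ R₂) ∩ O.verts ⊆ (A none).verts ∪ (B none).verts := by
    rintro x ⟨-, hx | (rfl | rfl) | hx⟩
    · exact .inl hx
    · exact .inl hA.root_mem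
    · exact .inr hB.root_mem
    · exact .inr hx
  refine ⟨ι ⊕ κ, inferInstance, mergeFamily O A B, ?_, ?_⟩
  · constructor
    · rintro (_ | i | j)
      · exact Connected.sup_of_mem (hA.connected _)
          (Connected.link_sup (hB.connected _) hvu.adj_sub hB.root_mem) hA.root_mem (.inl (.inl rfl))
      · exact hA.connected _
      · exact hB.connected _
    · rw [← hA.span, ← hB.span]
      simp only [iSup_option, iSup_sum, mergeFamily, O]
      ac_rfl
    · exact componentGraph_mergeFamily_isTree hA.tree hB.tree le_sup_left
        (le_sup_right.trans le_sup_right) hOv d₁ d₂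
        (hT.mono hR₁ hR₂)
    · exact .inl hA.root_mem
    · refine le_trans ?_ (Nat.add_le_add hA.card_root_le hB.card_root_le)
      refine le_trans (Set.ncard_le_ncard ?_) (Set.ncard_union_le _ _)
      intro x hx
      have h3 := hOv hx
      have h1 := d₁ none x
      have h2 := d₂ none x
      have := hx.1
      simp only [Set.mem_union, Set.mem_inter_iff] at *
      grind
    · rintro (i | j)
      · simp only [mergeFamily]
        rw [ncard_union_inter_of_left (d₂ _)]
        exact hA.card_le i
      · simp only [mergeFamily]
        rw [ncard_union_inter_of_right (d₁ _)]
        exact hB.card_le j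
    · simp only [Fintype.sum_sum_type, mergeFamily]
      have e1 := outerPower_sup_le c (A none) (link G v u ⊔ B none) v
      have e2 := outerPower_link_sup_le c ((hB.le none).trans hS) hvu
      calc _ ≤ ∑ i, power c (A (some i)) + ∑ j, power c (B (some j)) +
            (outerPower c (A none) v + (nodePower c S u + outerPower c (B none) u)) := by
              gcongr; exact e1.trans (by gcongr)
        _ = (∑ i, power c (A (some i)) + outerPower c (A none) v) + (nodePower c S u +
            (∑ j, power c (B (some j)) + outerPower c (B none) u)) := by ring
        _ ≤ _ := by gcongr; exacts [hA.cost_le, hB.cost_le]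
  · rintro (i | j)
    · exact hA' i
    · exact fun h => hT' ((hA.le none).1 hA.root_mem) ((hB.le _).1 h)

/-- Two subtrees with the common root `v` are put together without merging: the root component of
`T₂` is closed, after extending it by a connector `P` inside `T₁` to a single terminal of `T₁`. -/
lemma HasDec.glue {T₁ T₂ P : G.Subgraph} {R₁ R₂ : Set V} {v t : V} {N₁ N₂ : ℕ}
    {a₁ a₂ ω ω' : ℝ≥0} (h₁ : HasDec c R₁ k T₁ v N₁ a₁) (h₂ : HasStarDec c R₂ k T₂ v N₂ a₂)
    (hN : N₂ + 1 ≤ k) (hT : ∀ x ∈ T₁.verts, x ∈ T₂.verts → x = v)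
    (hR₁ : R₁ ⊆ T₁.verts) (hR₂ : R₂ ⊆ T₂.verts) (hvR : v ∉ R₂)
    (hP : P.Connected) (hPT : P ≤ T₁) (hvP : v ∈ P.verts) (ht : t ∈ R₁)
    (hPR : (R₁ ∪ R₂) ∩ P.verts = {t})
    (hω₁ : nodePower c T₂ v ≤ ω) (hω₂ : nodePower c P v ≤ ω) (hω' : outerPower c P v ≤ ω') :
    HasDec c (R₁ ∪ R₂) k (T₁ ⊔ T₂) v N₁ (a₁ + a₂ + (ω + ω')) := by
  obtain ⟨ι, _, A, hA⟩ := h₁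
  obtain ⟨κ, _, B, hB, hB'⟩ := h₂
  have d₁ : ∀ x ∈ R₁, ∀ j, x ∈ (B j).verts → x = v := fun x hx j hx' =>
    hT x (hR₁ hx) ((hB.le j).1 hx')
  have d₁' : ∀ j, ∀ x ∈ R₁, x ∉ (B (some j)).verts := fun j x hx hx' =>
    hB' j (d₁ x hx _ hx' ▸ hx')
  have d₁'' : ∀ x ∈ R₁, x ∈ (B none).verts → x = t := fun x hx hx' => by
    have hxv := d₁ x hx _ hx'
    have : x ∈ (R₁ ∪ R₂) ∩ P.verts := ⟨.inl hx, hxv ▸ hvP⟩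
    rwa [hPR] at this
  have d₂ : ∀ i, ∀ x ∈ R₂, x ∉ (A i).verts := fun i x hx hx' =>
    hvR (hT x ((hA.le i).1 hx') (hR₂ hx) ▸ hx)
  have hR : Disjoint R₁ R₂ := Set.disjoint_left.2 fun x hx hx' =>
    hvR (hT x (hR₁ hx) (hR₂ hx') ▸ hx')
  refine ⟨ι ⊕ Option κ, inferInstance, glueFamily P A B, ?_⟩
  constructor
  · rintro (_ | i | _ | j)
    · exact hA.connected _
    · exact hA.connected _
    · exact Connected.sup_of_mem (hB.connected _) hP hB.root_mem hvP
    · exact hB.connected _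
  · apply le_antisymm
    · refine iSup_le ?_
      rintro (_ | i | _ | j)
      · exact (hA.le _).trans le_sup_left
      · exact (hA.le _).trans le_sup_left
      · exact sup_le ((hB.le _).trans le_sup_right) (hPT.trans le_sup_left)
      · exact (hB.le _).trans le_sup_right
    · refine sup_le ?_ ?_
      · rw [← hA.span]
        refine iSup_le ?_
        rintro (_ | i)
        · exact le_iSup (glueFamily P A B) none
        · exact le_iSup (glueFamily P A B) (some (.inl i))
      · rw [← hB.span]
        refine iSup_le ?_
        rintro (_ | i)
        · exact le_sup_left.trans (le_iSup (glueFamily P A B) (some (.inr none)))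
        · exact le_iSup (glueFamily P A B) (some (.inr (some i)))
  · exact componentGraph_glueFamily_isTree hA.tree hB.tree hPR ht d₁'' d₁' d₂ hR
  · exact hA.root_mem
  · simp only [glueFamily]
    rw [ncard_union_inter_of_left (d₂ _)]
    exact hA.card_root_le
  · rintro (i | _ | j)
    · simp only [glueFamily]
      rw [ncard_union_inter_of_left (d₂ _)]
      exact hA.card_le i
    · refine le_trans ?_ hN
      refine le_trans (Set.ncard_le_ncard (t := (R₂ ∩ (B none).verts) ∪ {t}) ?_)
        ((Set.ncard_union_le _ _).trans ?_)
      · rintro x ⟨hx | hx, hx' | hx'⟩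
        · exact .inr (d₁'' x hx hx')
        · exact .inr (hPR ▸ ⟨.inl hx, hx'⟩)
        · exact .inl ⟨hx, hx'⟩
        · exact .inr (hPR ▸ ⟨.inr hx, hx'⟩)
      · rw [Set.ncard_singleton]
        exact Nat.add_le_add_right hB.card_root_le 1
    · simp only [glueFamily]
      rw [ncard_union_inter_of_right (d₁' _)]
      exact hB.card_le j
  · simp only [Fintype.sum_sum_type, Fintype.sum_option, glueFamily]
    have e1 : power c (B none ⊔ P) ≤ ω + (outerPower c (B none) v + ω') := by
      rw [power_eq_add_outerPower c _ v]
      refine add_le_add ((nodePower_sup_le c _ _ v).trans (max_le ?_ hω₂))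
        ((outerPower_sup_le c _ _ v).trans (by gcongr))
      exact (nodePower_mono c (hB.le none) v).trans hω₁
    calc _ ≤ ∑ i, power c (A (some i)) + (ω + (outerPower c (B none) v + ω') +
          ∑ j, power c (B (some j))) + outerPower c (A none) v := by gcongr
      _ = (∑ i, power c (A (some i)) + outerPower c (A none) v) +
          (∑ j, power c (B (some j)) + outerPower c (B none) v) + (ω + ω') := by ring
      _ ≤ _ := by gcongr; exacts [hA.cost_le, hB.cost_le]

/-- The root component is closed; the new root component is a connector from the root to a single
terminal. -/
lemma HasDec.cut {S T P : G.Subgraph} {R : Set V} {v t : V} {N : ℕ} {a ω' : ℝ≥0}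
    (h : HasDec c R k T v N a) (hN : N ≤ k) (hS : T ≤ S)
    (hP : P.Connected) (hPT : P ≤ T) (hvP : v ∈ P.verts)
    (hPR : R ∩ P.verts = {t}) (hω' : outerPower c P v ≤ ω') :
    HasDec c R k T v 1 (a + nodePower c S v + ω') := by
  obtain ⟨ι, _, A, hA⟩ := h
  refine ⟨Option ι, inferInstance, consFamily P A, ?_⟩
  constructor
  · rintro (_ | i)
    · exact hP
    · exact hA.connected i
  · rw [iSup_option]
    simp only [consFamily]
    rw [hA.span, sup_eq_right.2 hPT]
  · exact componentGraph_consFamily_isTree hA.tree hPR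
  · exact hvP
  · simp only [consFamily, hPR, Set.ncard_singleton, le_refl]
  · rintro (_ | i)
    · exact hA.card_root_le.trans hN
    · exact hA.card_le i
  · simp only [consFamily, Fintype.sum_option]
    rw [power_eq_add_outerPower c _ v]
    have e1 := nodePower_mono c ((hA.le none).trans hS) v
    calc _ ≤ nodePower c S v + outerPower c (A none) v + ∑ i, power c (A (some i)) + ω' := by gcongr
      _ = (∑ i, power c (A (some i)) + outerPower c (A none) v) + nodePower c S v + ω' := by ring
      _ ≤ _ := by gcongr; exact hA.cost_le

end MinPower

namespace MinPower

variable {V : Type*} {G : SimpleGraph V}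

/-! ### Fans of subtrees at a common root -/

/-- The subtrees `T u`, for `u ∈ X`, are pairwise disjoint subtrees of `S` avoiding `v`, each with
its root `u` adjacent to `v` in `S`. -/
structure IsFan (S : G.Subgraph) (v : V) (X : Finset V) (T : V → G.Subgraph) : Prop where
  adj : ∀ u ∈ X, S.Adj v u
  le : ∀ u ∈ X, T u ≤ S
  root_mem : ∀ u ∈ X, u ∈ (T u).verts
  notMem : ∀ u ∈ X, v ∉ (T u).verts
  disjoint : ∀ u ∈ X, ∀ w ∈ X, u ≠ w → Disjoint (T u).verts (T w).verts

/-- The union of the subtrees `T u`, for `u ∈ X`, and the edges joining their roots to `v`. -/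
def fan (v : V) (X : Finset V) (T : V → G.Subgraph) : G.Subgraph := X.sup fun u => link G v u ⊔ T u

lemma IsFan.mono {S : G.Subgraph} {v : V} {X Y : Finset V} {T : V → G.Subgraph}
    (h : IsFan S v X T) (hY : Y ⊆ X) : IsFan S v Y T :=
  ⟨fun u hu => h.adj u (hY hu), fun u hu => h.le u (hY hu), fun u hu => h.root_mem u (hY hu),
    fun u hu => h.notMem u (hY hu), fun u hu w hw => h.disjoint u (hY hu) w (hY hw)⟩

@[simp] lemma fan_empty (v : V) (T : V → G.Subgraph) : fan v ∅ T = ⊥ := rfl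

lemma fan_insert [DecidableEq V] (v u : V) (X : Finset V) (T : V → G.Subgraph) :
    fan v (insert u X) T = (link G v u ⊔ T u) ⊔ fan v X T := Finset.sup_insert

lemma fan_union [DecidableEq V] (v : V) (X Y : Finset V) (T : V → G.Subgraph) :
    fan v (X ∪ Y) T = fan v X T ⊔ fan v Y T := Finset.sup_union

lemma le_fan {v u : V} {X : Finset V} (T : V → G.Subgraph) (hu : u ∈ X) :
    link G v u ⊔ T u ≤ fan v X T := Finset.le_sup (f := fun u => link G v u ⊔ T u) hu

lemma fan_adj {v x y : V} {X : Finset V} {T : V → G.Subgraph} :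
    (fan v X T).Adj x y ↔ ∃ u ∈ X, (link G v u).Adj x y ∨ (T u).Adj x y := by
  classical
  induction X using Finset.induction_on with
  | empty => simp
  | insert u X hu ih => simp [fan_insert, ih]

lemma mem_fan {v x : V} {X : Finset V} {T : V → G.Subgraph} :
    x ∈ (fan v X T).verts ↔ ∃ u ∈ X, (x = v ∨ x = u) ∨ x ∈ (T u).verts := by
  classical
  induction X using Finset.induction_on with
  | empty => simp
  | insert u X hu ih => simp [fan_insert, ih, mem_link]

lemma IsFan.fan_le {S : G.Subgraph} {v : V} {X : Finset V} {T : V → G.Subgraph}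
    (h : IsFan S v X T) : fan v X T ≤ S :=
  Finset.sup_le fun u hu => sup_le (link_le (h.adj u hu)) (h.le u hu)

lemma IsFan.mem_fan {S : G.Subgraph} {v x : V} {X : Finset V} {T : V → G.Subgraph}
    (h : IsFan S v X T) (hx : x ∈ (fan v X T).verts) : x = v ∨ ∃ u ∈ X, x ∈ (T u).verts := by
  obtain ⟨u, hu, (rfl | rfl) | hx⟩ := MinPower.mem_fan.1 hx
  · exact .inl rfl
  · exact .inr ⟨_, hu, h.root_mem _ hu⟩
  · exact .inr ⟨_, hu, hx⟩

lemma IsFan.sup_fan_connected {S B : G.Subgraph} {v : V} {X : Finset V} {T : V → G.Subgraph}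
    (h : IsFan S v X T) (hT : ∀ u ∈ X, (T u).Connected) (hB : B.Connected) (hv : v ∈ B.verts) :
    (B ⊔ fan v X T).Connected := by
  classical
  induction X using Finset.induction_on with
  | empty => simpa
  | insert u X hu ih =>
    have hu' := Finset.mem_insert_self u X
    have h1 := ih (h.mono (Finset.subset_insert _ _))
      fun w hw => hT w (Finset.mem_insert_of_mem hw)
    have h2 := Connected.sup_of_mem h1
      (Connected.link_sup (hT u hu') (h.adj u hu').adj_sub (h.root_mem u hu'))
      (.inl hv) (.inl (.inl rfl))
    rw [fan_insert, sup_comm (link G v u ⊔ T u), ← sup_assoc]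
    exact h2

lemma IsFan.disjoint_sup_fan {S B : G.Subgraph} {v w : V} {X : Finset V} {T : V → G.Subgraph}
    (h : IsFan S v X T) (hv : v ∈ B.verts) (hB : Disjoint B.verts (T w).verts)
    (hw : ∀ u ∈ X, Disjoint (T u).verts (T w).verts) :
    Disjoint (B ⊔ fan v X T).verts (T w).verts := by
  rw [Set.disjoint_left]
  rintro x (hx | hx) hx'
  · exact Set.disjoint_left.1 hB hx hx'
  · rcases h.mem_fan hx with rfl | ⟨u, hu, hxu⟩
    · exact Set.disjoint_left.1 hB hv hx'
    · exact Set.disjoint_left.1 (hw u hu) hxu hx'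

lemma IsFan.powerOn_sup_fan [Fintype V] (c : Sym2 V → ℝ≥0) {S B : G.Subgraph} {v : V}
    {X : Finset V} {T : V → G.Subgraph} (h : IsFan S v X T) (hv : v ∈ B.verts)
    (hB : ∀ u ∈ X, Disjoint B.verts (T u).verts) :
    powerOn c S (B ⊔ fan v X T) = powerOn c S B + ∑ u ∈ X, powerOn c S (T u) := by
  classical
  induction X using Finset.induction_on with
  | empty => simp
  | insert u X hu ih =>
    have hu' := Finset.mem_insert_self u X
    have hX : X ⊆ insert u X := Finset.subset_insert _ _
    rw [fan_insert, sup_comm (link G v u ⊔ T u), ← sup_assoc, powerOn_sup_link_sup,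
      ih (h.mono hX) fun w hw => hB w (hX hw), Finset.sum_insert hu]
    · ring
    · exact (h.mono hX).disjoint_sup_fan hv (hB u hu')
        fun w hw => h.disjoint w (hX hw) u hu' (by rintro rfl; exact hu hw)
    · exact .inl hv
    · exact h.root_mem u hu'

/-- The `q` largest elements of a finset with respect to `f`. -/
lemma exists_subset_largest (f : V → ℝ≥0) (q : ℕ) (Y : Finset V) :
    ∃ Z ⊆ Y, Z.card ≤ q ∧ (Z ≠ Y → Z.card = q) ∧ ∀ z ∈ Z, ∀ y ∈ Y, y ∉ Z → f y ≤ f z := by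
  classical
  induction q with
  | zero => exact ⟨∅, by simp⟩
  | succ q ih =>
    obtain ⟨Z, hZ, hq, hq', hf⟩ := ih
    by_cases h : Z = Y
    · exact ⟨Z, hZ, hq.trans q.le_succ, fun h' => (h' h).elim, hf⟩
    · have hne : (Y \ Z).Nonempty := by
        rw [Finset.sdiff_nonempty]
        exact fun h' => h (hZ.antisymm h')
      obtain ⟨y, hy, hmax⟩ := Finset.exists_max_image (Y \ Z) f hne
      rw [Finset.mem_sdiff] at hy
      refine ⟨insert y Z, Finset.insert_subset hy.1 hZ, ?_, fun _ => ?_, ?_⟩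
      · rw [Finset.card_insert_of_notMem hy.2, hq' h]
      · rw [Finset.card_insert_of_notMem hy.2, hq' h]
      · intro z hz x hx hxZ
        rw [Finset.mem_insert, not_or] at hxZ
        rcases Finset.mem_insert.1 hz with rfl | hz
        · exact hmax x (Finset.mem_sdiff.2 ⟨hx, hxZ.2⟩)
        · exact hf z hz x hx hxZ.2

/-- A cheapest element costs at most the average. -/
lemma exists_le_div_mul_sum {W : V → ℝ≥0} {q : ℕ} {Z : Finset V} (hq : 1 ≤ q) (hZ : Z.card = q) :
    ∃ z ∈ Z, 2 * W z ≤ 2 / q * ∑ y ∈ Z, W y := by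
  obtain ⟨z, hz, hmin⟩ := Finset.exists_min_image Z W (Finset.card_pos.1 (by omega))
  refine ⟨z, hz, ?_⟩
  have h1 : (q : ℝ≥0) * W z ≤ ∑ y ∈ Z, W y := by
    rw [← hZ, ← nsmul_eq_mul]
    exact Finset.card_nsmul_le_sum _ _ _ hmin
  have h2 : (q : ℝ≥0) ≠ 0 := by positivity
  calc 2 * W z = 2 / q * (q * W z) := by field_simp
    _ ≤ _ := by gcongr

variable [Fintype V] {c : Sym2 V → ℝ≥0} {k : ℕ}

/-- Attaching all subtrees of a fan to `v` and merging all root components. -/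
lemma HasStarDec.merge_fan {S T₀ : G.Subgraph} {R R₀ : Set V} {v : V} {N₀ N : ℕ} {a₀ : ℝ≥0}
    {X : Finset V} {T : V → G.Subgraph} {a : V → ℝ≥0}
    (h₀ : HasStarDec c R₀ k T₀ v N₀ a₀) (hR₀ : R₀ ⊆ T₀.verts) (hv : v ∈ T₀.verts)
    (hX : IsFan S v X T) (hT : ∀ u ∈ X, Disjoint T₀.verts (T u).verts)
    (hdec : ∀ u ∈ X, HasDec c (R ∩ (T u).verts) k (T u) u N (a u)) :
    HasStarDec c (R₀ ∪ R ∩ ⋃ u ∈ X, (T u).verts) k (T₀ ⊔ fan v X T) v (N₀ + X.card * N)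
      (a₀ + ∑ u ∈ X, (nodePower c S u + a u)) := by
  classical
  induction X using Finset.induction_on with
  | empty => simpa using h₀
  | insert u X hu ih =>
    have hu' := Finset.mem_insert_self u X
    have hs : X ⊆ insert u X := Finset.subset_insert _ _
    have h1 := ih (hX.mono hs) (fun w hw => hT w (hs hw)) fun w hw => hdec w (hs hw)
    have h2 := h1.merge (hdec u hu') (hX.adj u hu') (hX.le u hu')
      ((hX.mono hs).disjoint_sup_fan hv (hT u hu')
        fun w hw => hX.disjoint w (hs hw) u hu' (by rintro rfl; exact hu hw))
      (by
        rintro x (hx | ⟨-, hx⟩)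
        · exact .inl (hR₀ hx)
        · simp only [Set.mem_iUnion, exists_prop] at hx
          obtain ⟨w, hw, hx⟩ := hx
          exact .inr (mem_fan.2 ⟨w, hw, .inr hx⟩))
      Set.inter_subset_right
    have e1 : R₀ ∪ R ∩ ⋃ w ∈ insert u X, (T w).verts
        = R₀ ∪ (R ∩ ⋃ w ∈ X, (T w).verts) ∪ R ∩ (T u).verts := by
      rw [Finset.set_biUnion_insert, Set.inter_union_distrib_left, Set.union_assoc,
        Set.union_comm (R ∩ (T u).verts)]
    rw [e1, fan_insert, sup_comm (link G v u ⊔ T u), ← sup_assoc, Finset.card_insert_of_notMem hu,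
      Finset.sum_insert hu, add_comm (nodePower c S u + a u), ← add_assoc,
      show N₀ + (X.card + 1) * N = N₀ + X.card * N + N by ring]
    exact h2

/-! ### Splitting a node of high degree -/

/-- There is a connected subgraph of `T` that joins `v` to exactly one terminal; its power is at
most `ω` at `v` and at most `ω'` at all other nodes together. -/
def HasConnector (c : Sym2 V → ℝ≥0) (R : Set V) (v : V) (T : G.Subgraph) (ω ω' : ℝ≥0) : Prop :=
  ∃ P : G.Subgraph, P.Connected ∧ P ≤ T ∧ v ∈ P.verts ∧ (∃ t, R ∩ P.verts = {t}) ∧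
    nodePower c P v ≤ ω ∧ outerPower c P v ≤ ω'

lemma HasConnector.mono {R : Set V} {v : V} {T T' : G.Subgraph} {ω ω' : ℝ≥0}
    (h : HasConnector c R v T ω ω') (hT : T ≤ T') : HasConnector c R v T' ω ω' := by
  obtain ⟨P, h1, h2, h3⟩ := h
  exact ⟨P, h1, h2.trans hT, h3⟩

/-- The subtrees of a fan are added to `T₁` in chunks of `q`, in the order of decreasing cost of the
edges at `v`. The root component of each chunk is linked to a terminal of the preceding chunk, by
the cheapest of `q` connectors. This connector also pays for the power of `v` in the new component,
as the edges of the new chunk cost no more than its edge at `v`. -/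
lemma HasDec.glue_fan {S T₁ : G.Subgraph} {R : Set V} {v : V} {N₁ N q : ℕ} {Y : Finset V}
    {T : V → G.Subgraph} {a W : V → ℝ≥0} {a₁ ω ω' : ℝ≥0} (hq : 1 ≤ q) (hN : q * N + 1 ≤ k)
    (hY : IsFan S v Y T) (hT : ∀ u ∈ Y, Disjoint T₁.verts (T u).verts)
    (hdec : ∀ u ∈ Y, HasDec c (R ∩ (T u).verts) k (T u) u N (a u))
    (hconn : ∀ u ∈ Y, HasConnector c R v (G.singletonSubgraph v ⊔ (link G v u ⊔ T u))
      (c s(v, u)) (W u))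
    (hW : ∀ u ∈ Y, c s(v, u) ≤ W u) (hv : v ∈ T₁.verts)
    (h₁ : HasDec c (R ∩ T₁.verts) k T₁ v N₁ a₁)
    (hP : HasConnector c R v T₁ ω ω') (hω : ∀ u ∈ Y, c s(v, u) ≤ ω) :
    HasDec c (R ∩ (T₁ ⊔ fan v Y T).verts) k (T₁ ⊔ fan v Y T) v N₁
      (a₁ + ∑ u ∈ Y, (nodePower c S u + a u) + (ω + ω') + 2 / q * ∑ u ∈ Y, W u) := by
  classical
  induction Y using Finset.strongInduction generalizing T₁ a₁ ω ω' with
  | H Y ih =>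
    rcases Y.eq_empty_or_nonempty with rfl | hne
    · simp only [fan_empty, sup_bot_eq, Finset.sum_empty, add_zero, mul_zero]
      exact h₁.mono le_rfl le_self_add
    obtain ⟨Z, hZ, hZq, hZY, hmax⟩ := exists_subset_largest (fun u => c s(v, u)) q Y
    have hfZ := hY.mono hZ
    -- the new chunk, with its own root component
    have h2 := (HasStarDec.single (c := c) (k := k) (R := ∅) (v := v)
      (B := G.singletonSubgraph v) SimpleGraph.Subgraph.singletonSubgraph_connected rfl
      (Set.empty_subset _)).merge_fan (Set.empty_subset _) rfl hfZ
      (fun u hu => Set.disjoint_singleton_left.2 (hfZ.notMem u hu)) (fun u hu => hdec u (hZ hu))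
    rw [Set.ncard_empty, Set.empty_union, zero_add] at h2
    have hout : outerPower c (G.singletonSubgraph v) v = 0 :=
      Finset.sum_eq_zero fun x _ => nodePower_eq_zero c fun u hu => hu
    rw [hout, zero_add] at h2
    set T₂ : G.Subgraph := G.singletonSubgraph v ⊔ fan v Z T with hT₂
    have hverts : ∀ x ∈ T₂.verts, x = v ∨ ∃ u ∈ Z, x ∈ (T u).verts := by
      rintro x (hx | hx)
      · exact .inl hx
      · exact hfZ.mem_fan hx
    have hR₂ : (R ∩ ⋃ u ∈ Z, (T u).verts) ⊆ T₂.verts := by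
      rintro x ⟨-, hx⟩
      simp only [Set.mem_iUnion, exists_prop] at hx
      obtain ⟨u, hu, hx⟩ := hx
      exact .inr (mem_fan.2 ⟨u, hu, .inr hx⟩)
    have hvR : v ∉ R ∩ ⋃ u ∈ Z, (T u).verts := by
      rintro ⟨-, hx⟩
      simp only [Set.mem_iUnion, exists_prop] at hx
      obtain ⟨u, hu, hx⟩ := hx
      exact hfZ.notMem u hu hx
    have hRU : R ∩ T₁.verts ∪ R ∩ ⋃ u ∈ Z, (T u).verts = R ∩ (T₁ ⊔ T₂).verts := by
      ext x
      constructor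
      · rintro (hx | hx)
        · exact ⟨hx.1, .inl hx.2⟩
        · exact ⟨hx.1, .inr (hR₂ hx)⟩
      · rintro ⟨hxR, hx | hx⟩
        · exact .inl ⟨hxR, hx⟩
        · rcases hverts x hx with rfl | ⟨u, hu, hx⟩
          · exact .inl ⟨hxR, hv⟩
          · exact .inr ⟨hxR, by simp only [Set.mem_iUnion, exists_prop]; exact ⟨u, hu, hx⟩⟩
    obtain ⟨P, hPc, hPT, hvP, ⟨t, ht⟩, hPω, hPω'⟩ := hP
    have ht' : t ∈ R ∩ P.verts := ht.ge rfl
    have h3 := h₁.glue h2 ((Nat.add_le_add_right (Nat.mul_le_mul_right N hZq) 1).trans hN)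
      (fun x hx hx' => by
        rcases hverts x hx' with rfl | ⟨u, hu, hxu⟩
        · rfl
        · exact (Set.disjoint_left.1 (hT u (hZ hu)) hx hxu).elim)
      Set.inter_subset_right hR₂ hvR hPc hPT hvP ⟨ht'.1, hPT.1 ht'.2⟩
      (by
        rw [hRU, ← ht]
        ext x
        exact ⟨fun h => ⟨h.1.1, h.2⟩, fun h => ⟨⟨h.1, .inl (hPT.1 h.2)⟩, h.2⟩⟩)
      (nodePower_le fun u hu => by
        rcases hu with hu | hu
        · exact hu.elim
        obtain ⟨w, hw, hu | hu⟩ := fan_adj.1 hu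
        · rcases (link_adj.1 hu).2 with ⟨-, rfl⟩ | ⟨h1, -⟩
          · exact hω _ (hZ hw)
          · exact ((hY.adj w (hZ hw)).ne h1).elim
        · exact (hfZ.notMem w hw hu.fst_mem).elim) hPω hPω'
    rw [hRU] at h3
    by_cases hZY' : Z = Y
    · subst hZY'
      have e : T₁ ⊔ T₂ = T₁ ⊔ fan v Z T := by
        rw [hT₂, ← sup_assoc, sup_eq_left.2 ((SimpleGraph.singletonSubgraph_le_iff v T₁).2 hv)]
      rw [e] at h3
      exact h3.mono le_rfl le_self_add
    -- the connector for the next chunk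
    obtain ⟨z, hz, hzW⟩ := exists_le_div_mul_sum (W := W) hq (hZY hZY')
    have h4 := ih (Y \ Z) (Finset.sdiff_ssubset hZ (Finset.card_pos.1 (by rw [hZY hZY']; omega)))
      (hY.mono Finset.sdiff_subset)
      (T₁ := T₁ ⊔ T₂) (ω := c s(v, z)) (ω' := W z)
      (fun u hu => by
        rw [Finset.mem_sdiff] at hu
        have := (hfZ.disjoint_sup_fan (B := T₁) hv (hT u hu.1) fun w hw =>
          hY.disjoint w (hZ hw) u hu.1 (by rintro rfl; exact hu.2 hw))
        refine this.mono_left ?_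
        rintro x (hx | rfl | hx)
        · exact .inl hx
        · exact .inl hv
        · exact .inr hx)
      (fun u hu => hdec u (Finset.sdiff_subset hu)) (fun u hu => hconn u (Finset.sdiff_subset hu))
      (fun u hu => hW u (Finset.sdiff_subset hu)) (.inl hv) h3
      ((hconn z (hZ hz)).mono ((sup_le_sup_left (le_fan T hz) _).trans le_sup_right))
      (fun u hu => by
        rw [Finset.mem_sdiff] at hu
        exact hmax z hz u hu.1 hu.2)
    have e : T₁ ⊔ T₂ ⊔ fan v (Y \ Z) T = T₁ ⊔ fan v Y T := by
      conv_rhs => rw [← Finset.union_sdiff_of_subset hZ, fan_union]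
      rw [hT₂, ← sup_assoc, sup_eq_left.2 ((SimpleGraph.singletonSubgraph_le_iff v T₁).2 hv),
        sup_assoc]
    rw [e] at h4
    refine h4.mono le_rfl ?_
    rw [← Finset.sum_sdiff hZ, ← Finset.sum_sdiff hZ, mul_add]
    calc _ ≤ a₁ + ∑ u ∈ Z, (nodePower c S u + a u) + (ω + ω') +
          ∑ u ∈ Y \ Z, (nodePower c S u + a u) + 2 * W z + 2 / q * ∑ u ∈ Y \ Z, W u := by
            rw [two_mul]
            gcongr
            exact hW z (hZ hz)
      _ ≤ a₁ + ∑ u ∈ Z, (nodePower c S u + a u) + (ω + ω') +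
          ∑ u ∈ Y \ Z, (nodePower c S u + a u) + (2 / q * ∑ u ∈ Z, W u) +
            2 / q * ∑ u ∈ Y \ Z, W u := by gcongr
      _ = _ := by ring

/-- All subtrees of a fan are attached to a base containing `v`. The first chunk, merged with the
base, may contain one more subtree (that of `D`), which provides none of the connectors. -/
lemma HasDec.of_fan {S B : G.Subgraph} {R : Set V} {v : V} {N q : ℕ} {D Y : Finset V}
    [DecidableEq V] {T : V → G.Subgraph} {a W : V → ℝ≥0} (hq : 1 ≤ q) (hN : q * N + 1 ≤ k)
    (hf : IsFan S v (D ∪ Y) T) (hD : D.card ≤ 1) (hDY : Disjoint D Y)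
    (hB : B.Connected) (hv : v ∈ B.verts) (hBR : R ∩ B.verts ⊆ {v})
    (hT : ∀ u ∈ D ∪ Y, Disjoint B.verts (T u).verts)
    (hdec : ∀ u ∈ D ∪ Y, HasDec c (R ∩ (T u).verts) k (T u) u N (a u))
    (hconn : ∀ u ∈ Y, HasConnector c R v (G.singletonSubgraph v ⊔ (link G v u ⊔ T u))
      (c s(v, u)) (W u))
    (hW : ∀ u ∈ Y, c s(v, u) ≤ W u) :
    HasDec c (R ∩ (B ⊔ fan v (D ∪ Y) T).verts) k (B ⊔ fan v (D ∪ Y) T) v (1 + (q + 1) * N)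
      (outerPower c B v + ∑ u ∈ D ∪ Y, (nodePower c S u + a u) + 2 / q * ∑ u ∈ Y, W u) := by
  obtain ⟨Z, hZ, hZq, hZY, hmax⟩ := exists_subset_largest (fun u => c s(v, u)) q Y
  have hDZ : D ∪ Z ⊆ D ∪ Y := Finset.union_subset_union_right hZ
  have hfZ := hf.mono hDZ
  have h1 := ((HasStarDec.single (c := c) (k := k) (R := R ∩ B.verts) hB hv
    Set.inter_subset_right).merge_fan (R := R) Set.inter_subset_right hv hfZ
      (fun u hu => hT u (hDZ hu)) (fun u hu => hdec u (hDZ hu))).hasDec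
  have hRU : R ∩ B.verts ∪ R ∩ ⋃ u ∈ D ∪ Z, (T u).verts
      = R ∩ (B ⊔ fan v (D ∪ Z) T).verts := by
    ext x
    simp only [Set.mem_union, Set.mem_inter_iff, Set.mem_iUnion, exists_prop]
    constructor
    · rintro (hx | ⟨hx, u, hu, hxu⟩)
      · exact ⟨hx.1, .inl hx.2⟩
      · exact ⟨hx, .inr (mem_fan.2 ⟨u, hu, .inr hxu⟩)⟩
    · rintro ⟨hxR, hx | hx⟩
      · exact .inl ⟨hxR, hx⟩
      · rcases hfZ.mem_fan hx with rfl | ⟨u, hu, hx⟩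
        · exact .inl ⟨hxR, hv⟩
        · exact .inr ⟨hxR, u, hu, hx⟩
  rw [hRU] at h1
  have hcard : (R ∩ B.verts).ncard + (D ∪ Z).card * N ≤ 1 + (q + 1) * N := by
    have e1 : (R ∩ B.verts).ncard ≤ 1 := by
      simpa using Set.ncard_le_ncard hBR
    have e2 : (D ∪ Z).card ≤ q + 1 := (Finset.card_union_le _ _).trans (by omega)
    exact Nat.add_le_add e1 (Nat.mul_le_mul_right N e2)
  by_cases hZY' : Z = Y
  · subst hZY'
    exact h1.mono hcard le_self_add
  obtain ⟨z, hz, hzW⟩ := exists_le_div_mul_sum (W := W) hq (hZY hZY')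
  have hsub : Y \ Z ⊆ D ∪ Y := Finset.sdiff_subset.trans Finset.subset_union_right
  have hdisj : Disjoint (D ∪ Z) (Y \ Z) :=
    Finset.disjoint_union_left.2 ⟨hDY.mono_right Finset.sdiff_subset, Finset.disjoint_sdiff⟩
  have hun : D ∪ Z ∪ (Y \ Z) = D ∪ Y := by
    rw [Finset.union_assoc, Finset.union_sdiff_of_subset hZ]
  have h2 := HasDec.glue_fan (S := S) (Y := Y \ Z) (W := W) hq hN (hf.mono hsub)
    (fun u hu => hfZ.disjoint_sup_fan hv (hT u (hsub hu)) fun w hw =>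
      hf.disjoint w (hDZ hw) u (hsub hu)
        (by rintro rfl; exact Finset.disjoint_left.1 hdisj hw hu))
    (fun u hu => hdec u (hsub hu)) (fun u hu => hconn u (Finset.sdiff_subset hu))
    (fun u hu => hW u (Finset.sdiff_subset hu)) (.inl hv) h1
    ((hconn z (hZ hz)).mono (sup_le
      (((SimpleGraph.singletonSubgraph_le_iff v B).2 hv).trans le_sup_left)
      ((le_fan T (Finset.mem_union_right D hz)).trans le_sup_right)))
    (fun u hu => hmax z hz u (Finset.mem_sdiff.1 hu).1 (Finset.mem_sdiff.1 hu).2)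
  rw [sup_assoc, ← fan_union, hun] at h2
  refine h2.mono hcard ?_
  rw [← hun, Finset.sum_union hdisj, ← Finset.sum_sdiff hZ, mul_add]
  calc _ ≤ outerPower c B v + ∑ u ∈ D ∪ Z, (nodePower c S u + a u) +
        ∑ u ∈ Y \ Z, (nodePower c S u + a u) + 2 * W z + 2 / q * ∑ u ∈ Y \ Z, W u := by
          rw [two_mul]
          gcongr
          exact hW z (hZ hz)
    _ ≤ outerPower c B v + ∑ u ∈ D ∪ Z, (nodePower c S u + a u) +
        ∑ u ∈ Y \ Z, (nodePower c S u + a u) + (2 / q * ∑ u ∈ Z, W u) +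
          2 / q * ∑ u ∈ Y \ Z, W u := by gcongr
    _ = _ := by ring

end MinPower

namespace MinPower

variable {V : Type*} {G : SimpleGraph V} [Fintype V]

/-! ### The inductive step along the tree -/

/-- The induction hypothesis for a subtree `T` of `S` with root `v`. A connected subgraph joining
`v` to a single terminal of `T` has nodes of total power at most `W`. For every number `l < h` of
levels that the root component may still have below `v`, there is a decomposition with root
component of at most `h ^ l` terminals and of cost `a l`. In total over all `l`, the excess over
the power of `T` is at most a constant multiple of the power of the nodes of `T`, apart from a share
`W` that is set aside: the connector of `v` has not been paid for yet. -/
structure IsLive (c : Sym2 V → ℝ≥0) (S : G.Subgraph) (R : Set V) (h : ℕ) (T : G.Subgraph) (v : V)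
    (W : ℝ≥0) (a : ℕ → ℝ≥0) : Prop where
  connector : ∃ P : G.Subgraph, P.Connected ∧ P ≤ T ∧ v ∈ P.verts ∧ (∃ t, R ∩ P.verts = {t}) ∧
    powerOn c S P ≤ W
  dec : ∀ l < h, HasDec c (R ∩ T.verts) (h ^ h) T v (h ^ l) (a l)
  budget : ∑ l ∈ Finset.range h, a l + h * nodePower c S v + 7 * W ≤ (h + 8) * powerOn c S T

variable {c : Sym2 V → ℝ≥0} {S : G.Subgraph} {R : Set V} {h : ℕ}

lemma powerOn_singleton (v : V) : powerOn c S (G.singletonSubgraph v) = nodePower c S v := by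
  classical
  unfold powerOn
  rw [Finset.sum_eq_single v] <;> simp +contextual

lemma IsLive.cost_le {T : G.Subgraph} {u v : V} {W : ℝ≥0} {a : ℕ → ℝ≥0}
    (hT : IsLive c S R h T u W a) (hvu : S.Adj v u) : c s(v, u) ≤ W := by
  obtain ⟨P, -, -, hu, -, hW⟩ := hT.connector
  rw [Sym2.eq_swap]
  exact (le_nodePower c hvu.symm).trans ((nodePower_le_powerOn c S hu).trans hW)

/-- A connector below the child `u` extends to the nonterminal `v`. -/
lemma IsLive.hasConnector {T : G.Subgraph} {u v : V} {W : ℝ≥0} {a : ℕ → ℝ≥0}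
    (hT : IsLive c S R h T u W a) (hTS : T ≤ S) (hvu : S.Adj v u) (hv : v ∉ T.verts)
    (hvR : v ∉ R) :
    HasConnector c R v (G.singletonSubgraph v ⊔ (link G v u ⊔ T)) (c s(v, u)) W := by
  obtain ⟨P, hP, hPT, hu, ⟨t, ht⟩, hW⟩ := hT.connector
  refine ⟨link G v u ⊔ P, Connected.link_sup hP hvu.adj_sub hu,
    (sup_le_sup_left hPT _).trans le_sup_right, .inl (.inl rfl), ⟨t, ?_⟩, ?_, ?_⟩
  · rw [← ht]
    ext x
    constructor
    · rintro ⟨hx, (rfl | rfl) | hx'⟩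
      · exact (hvR hx).elim
      · exact ⟨hx, hu⟩
      · exact ⟨hx, hx'⟩
    · exact fun hx => ⟨hx.1, .inr hx.2⟩
  · refine nodePower_le fun w hw => ?_
    rcases hw with hw | hw
    · rcases (link_adj.1 hw).2 with ⟨-, rfl⟩ | ⟨h1, -⟩
      · exact le_rfl
      · exact (hvu.ne h1).elim
    · exact (hv (hPT.1 hw.fst_mem)).elim
  · exact (outerPower_link_sup_le c (hPT.trans hTS) hvu).trans
      ((outerPower_le_powerOn c (hPT.trans hTS) hu).trans hW)

lemma hasConnector_of_mem {v : V} (hv : v ∈ R) {T : G.Subgraph} (hT : v ∈ T.verts) (ω ω' : ℝ≥0) :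
    HasConnector c R v T ω ω' := by
  refine ⟨G.singletonSubgraph v, SimpleGraph.Subgraph.singletonSubgraph_connected,
    (SimpleGraph.singletonSubgraph_le_iff v T).2 hT, rfl, ⟨v, by simpa using hv⟩, ?_, ?_⟩
  · exact nodePower_le fun u hu => hu.elim
  · refine le_trans (le_of_eq ?_) (zero_le (a := ω'))
    exact Finset.sum_eq_zero fun x _ => nodePower_eq_zero c fun u hu => hu

/-- At a terminal or a branching node `v` a new level starts: `l + 1` levels at `v` leave `l` levels
at the children, and with no level left the component is closed at `v`, which starts a component
with all levels available. The children in `Y` compete for providing connectors, so their shares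
`W` are spent here; that of the possible child in `D` is passed on to `v`. -/
lemma isLive_of_fan {B : G.Subgraph} {v : V} {D Y : Finset V} [DecidableEq V] {T : V → G.Subgraph}
    {W : V → ℝ≥0} {a : V → ℕ → ℝ≥0} {W' ω κ : ℝ≥0} (hh : 3 ≤ h)
    (hf : IsFan S v (D ∪ Y) T) (hD : D.card ≤ 1) (hDY : Disjoint D Y)
    (hB : B.Connected) (hBS : B ≤ S) (hv : v ∈ B.verts) (hBR : R ∩ B.verts ⊆ {v})
    (hT : ∀ u ∈ D ∪ Y, Disjoint B.verts (T u).verts)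
    (hlive : ∀ u ∈ D ∪ Y, IsLive c S R h (T u) u (W u) (a u))
    (hconn : ∀ u ∈ Y, HasConnector c R v (G.singletonSubgraph v ⊔ (link G v u ⊔ T u))
      (c s(v, u)) (W u))
    (hcut : HasConnector c R v (B ⊔ fan v (D ∪ Y) T) ω κ) (hκ : κ ≤ ∑ u ∈ Y, W u)
    (hW' : W' ≤ nodePower c S v + ∑ u ∈ D, W u)
    (hP : ∃ P : G.Subgraph, P.Connected ∧ P ≤ B ⊔ fan v (D ∪ Y) T ∧ v ∈ P.verts ∧
      (∃ t, R ∩ P.verts = {t}) ∧ powerOn c S P ≤ W') :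
    ∃ a', IsLive c S R h (B ⊔ fan v (D ∪ Y) T) v W' a' := by
  obtain ⟨q, rfl⟩ : ∃ q, h = q + 2 := ⟨h - 2, by omega⟩
  have hq : 1 ≤ q := by omega
  set h := q + 2 with hhq
  set T' := B ⊔ fan v (D ∪ Y) T with hT'
  let E : ℕ → ℝ≥0 := fun l => outerPower c B v + ∑ u ∈ D ∪ Y, (nodePower c S u + a u l) +
    2 / q * ∑ u ∈ Y, W u
  have hdec : ∀ l < h, HasDec c (R ∩ T'.verts) (h ^ h) T' v (h ^ (l + 1)) (E l) := by
    intro l hl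
    have hpos : 0 < (q + 2) ^ l := by positivity
    have hpow : h ^ (l + 1) ≤ h ^ h := Nat.pow_le_pow_right (by omega) hl
    refine (HasDec.of_fan (S := S) (N := h ^ l) (a := fun u => a u l) hq ?_ hf hD hDY hB hv hBR hT
      (fun u hu => (hlive u hu).dec l hl) hconn
      (fun u hu => (hlive u (Finset.mem_union_right D hu)).cost_le
        (hf.adj u (Finset.mem_union_right D hu)))).mono ?_ le_rfl
    · refine le_trans ?_ hpow
      rw [pow_succ, hhq]
      nlinarith
    · rw [pow_succ, hhq]
      nlinarith
  refine ⟨fun l => if l = 0 then E (h - 1) + nodePower c S v + κ else E (l - 1), hP, ?_, ?_⟩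
  · intro l hl
    obtain _ | l := l
    · obtain ⟨P, hPc, hPT, hvP, ⟨t, ht⟩, -, hPκ⟩ := hcut
      have h1 := hdec (h - 1) (by omega)
      rw [show h - 1 + 1 = h by omega] at h1
      simp only [if_true, pow_zero]
      refine h1.cut (S := S) le_rfl (sup_le hBS hf.fan_le) hPc hPT hvP (t := t) ?_ hPκ
      rw [← ht]
      ext x
      exact ⟨fun hx => ⟨hx.1.1, hx.2⟩, fun hx => ⟨⟨hx.1, hPT.1 hx.2⟩, hx.2⟩⟩
    · simpa using hdec l (by omega)
  · have hsum : ∑ l ∈ Finset.range h, (if l = 0 then E (h - 1) + nodePower c S v + κ else E (l - 1))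
        = ∑ l ∈ Finset.range h, E l + nodePower c S v + κ := by
      rw [hhq, Finset.sum_range_succ', Finset.sum_range_succ E (q + 1)]
      simp [add_assoc]
    have hE : ∑ l ∈ Finset.range h, E l = h * outerPower c B v +
        ∑ u ∈ D ∪ Y, (h * nodePower c S u + ∑ l ∈ Finset.range h, a u l) +
        h * (2 / q) * ∑ u ∈ Y, W u := by
      simp only [E, Finset.sum_add_distrib, Finset.sum_const, Finset.card_range, nsmul_eq_mul]
      rw [Finset.sum_comm]
      simp only [← Finset.mul_sum]
      ring
    have h6 : (h : ℝ≥0) * (2 / q) ≤ 6 := by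
      have h0 : (0 : ℝ≥0) < q := by exact_mod_cast hq
      rw [← mul_div_assoc, div_le_iff₀ h0, hhq]
      have : (q + 2) * 2 ≤ 6 * q := by omega
      exact_mod_cast this
    have hpow : powerOn c S T' = powerOn c S B + ∑ u ∈ D ∪ Y, powerOn c S (T u) :=
      hf.powerOn_sup_fan c hv hT
    have hBp := outerPower_le_powerOn c hBS hv
    have hvB := nodePower_le_powerOn c S hv
    rw [hsum, hE, hpow]
    have hWsum : ∑ u ∈ D ∪ Y, W u = ∑ u ∈ D, W u + ∑ u ∈ Y, W u := Finset.sum_union hDY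
    have hbud : ∑ u ∈ D ∪ Y, (h * nodePower c S u + ∑ l ∈ Finset.range h, a u l) +
        7 * ∑ u ∈ D ∪ Y, W u ≤ (h + 8) * ∑ u ∈ D ∪ Y, powerOn c S (T u) := by
      rw [Finset.mul_sum, Finset.mul_sum, ← Finset.sum_add_distrib]
      refine Finset.sum_le_sum fun u hu => ?_
      rw [add_comm ((h : ℝ≥0) * _)]
      exact (hlive u hu).budget
    calc _ ≤ h * outerPower c B v +
          ∑ u ∈ D ∪ Y, (h * nodePower c S u + ∑ l ∈ Finset.range h, a u l) +
          6 * ∑ u ∈ Y, W u + nodePower c S v + ∑ u ∈ Y, W u + h * nodePower c S v +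
          7 * (nodePower c S v + ∑ u ∈ D, W u) := by gcongr
      _ = h * (nodePower c S v + outerPower c B v) + 8 * nodePower c S v +
          (∑ u ∈ D ∪ Y, (h * nodePower c S u + ∑ l ∈ Finset.range h, a u l) +
            7 * ∑ u ∈ D ∪ Y, W u) := by rw [hWsum]; ring
      _ ≤ h * powerOn c S B + 8 * powerOn c S B +
          (h + 8) * ∑ u ∈ D ∪ Y, powerOn c S (T u) := by gcongr
      _ = _ := by ring

/-- A nonterminal with a single child is passed through without using up a level. -/
lemma isLive_of_single {B T : G.Subgraph} {u v : V} {W : ℝ≥0} {a : ℕ → ℝ≥0}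
    (hvu : S.Adj v u) (hTS : T ≤ S) (hu : u ∈ T.verts) (hvT : v ∉ T.verts)
    (hB : B.Connected) (hBS : B ≤ S) (hv : v ∈ B.verts) (hvR : v ∉ R) (hBR : R ∩ B.verts = ∅)
    (hBT : Disjoint B.verts T.verts) (hT : IsLive c S R h T u W a) :
    IsLive c S R h (B ⊔ (link G v u ⊔ T)) v (nodePower c S v + W)
      (fun l => outerPower c B v + (nodePower c S u + a l)) := by
  refine ⟨?_, ?_, ?_⟩
  · obtain ⟨P, hP, hPT, huP, ⟨t, ht⟩, hW⟩ := hT.connector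
    have hvB := (SimpleGraph.singletonSubgraph_le_iff v B).2 hv
    refine ⟨G.singletonSubgraph v ⊔ (link G v u ⊔ P),
      Connected.sup_of_mem SimpleGraph.Subgraph.singletonSubgraph_connected
        (Connected.link_sup hP hvu.adj_sub huP) rfl (.inl (.inl rfl)),
      sup_le_sup hvB (sup_le_sup_left hPT _), .inl rfl, ⟨t, ?_⟩, ?_⟩
    · rw [← ht]
      ext x
      constructor
      · rintro ⟨hx, rfl | (rfl | rfl) | hx'⟩
        · exact (hvR hx).elim
        · exact (hvR hx).elim
        · exact ⟨hx, huP⟩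
        · exact ⟨hx, hx'⟩
      · exact fun hx => ⟨hx.1, .inr (.inr hx.2)⟩
    · rw [powerOn_sup_link_sup c S (Set.disjoint_singleton_left.2 fun hx => hvT (hPT.1 hx)) rfl huP,
        powerOn_singleton]
      gcongr
  · intro l hl
    have h1 := (HasStarDec.single (c := c) (k := h ^ h) (R := ∅) hB hv
      (Set.empty_subset _)).merge (hT.dec l hl) hvu hTS hBT (Set.empty_subset _)
      Set.inter_subset_right
    rw [Set.ncard_empty, zero_add, Set.empty_union] at h1
    have e : R ∩ T.verts = R ∩ (B ⊔ (link G v u ⊔ T)).verts := by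
      ext x
      constructor
      · exact fun hx => ⟨hx.1, .inr (.inr hx.2)⟩
      · rintro ⟨hx, hx' | (rfl | rfl) | hx'⟩
        · exact (hBR.le ⟨hx, hx'⟩).elim
        · exact (hvR hx).elim
        · exact ⟨hx, hu⟩
        · exact ⟨hx, hx'⟩
    rw [← e]
    exact h1.hasDec
  · rw [powerOn_sup_link_sup c S hBT hv hu]
    have hBp := outerPower_le_powerOn c hBS hv
    have hvB := nodePower_le_powerOn c S hv
    have := hT.budget
    simp only [Finset.sum_add_distrib, Finset.sum_const, Finset.card_range, nsmul_eq_mul]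
    calc _ = h * (nodePower c S v + outerPower c B v) + 7 * nodePower c S v +
          (∑ l ∈ Finset.range h, a l + h * nodePower c S u + 7 * W) := by ring
      _ ≤ h * powerOn c S B + 8 * powerOn c S B + (h + 8) * powerOn c S T := by
          gcongr; norm_num
      _ = _ := by ring

/-- The induction hypothesis passes from the subtrees of the children to that of `v`. Subtrees
without terminals join the base that contains `v`. -/
lemma live_or_dead_step {v : V} {U : Finset V} {T : V → G.Subgraph} (hh : 3 ≤ h) (hvS : v ∈ S.verts)
    (hf : IsFan S v U T) (hc : ∀ u ∈ U, (T u).Connected)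
    (hU : ∀ u ∈ U, R ∩ (T u).verts = ∅ ∨ ∃ W a, IsLive c S R h (T u) u W a) :
    R ∩ (G.singletonSubgraph v ⊔ fan v U T).verts = ∅ ∨
      ∃ W a, IsLive c S R h (G.singletonSubgraph v ⊔ fan v U T) v W a := by
  classical
  set X := U.filter fun u => R ∩ (T u).verts ≠ ∅ with hX
  set Z := U.filter fun u => ¬ R ∩ (T u).verts ≠ ∅ with hZ
  have hXU : X ⊆ U := Finset.filter_subset _ _
  have hZU : Z ⊆ U := Finset.filter_subset _ _
  have hun : Z ∪ X = U := by rw [Finset.union_comm]; exact Finset.filter_union_filter_not_eq _ _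
  have hXZ : Disjoint X Z := Finset.disjoint_filter_filter_not _ _ _
  set B := G.singletonSubgraph v ⊔ fan v Z T with hBdef
  have hv : v ∈ B.verts := .inl rfl
  have hBc : B.Connected := (hf.mono hZU).sup_fan_connected (fun u hu => hc u (hZU hu))
    SimpleGraph.Subgraph.singletonSubgraph_connected rfl
  have hBS : B ≤ S := sup_le ((SimpleGraph.singletonSubgraph_le_iff v S).2 hvS) (hf.mono hZU).fan_le
  have hBR : R ∩ B.verts ⊆ {v} := by
    rintro x ⟨hxR, hx | hx⟩
    · exact hx
    · rcases (hf.mono hZU).mem_fan hx with rfl | ⟨u, hu, hxu⟩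
      · rfl
      · exact ((not_not.1 (Finset.mem_filter.1 hu).2).le ⟨hxR, hxu⟩).elim
  have hBX : ∀ u ∈ X, Disjoint B.verts (T u).verts := fun u hu =>
    (hf.mono hZU).disjoint_sup_fan rfl (Set.disjoint_singleton_left.2 (hf.notMem u (hXU hu)))
      fun w hw => hf.disjoint w (hZU hw) u (hXU hu)
        (by rintro rfl; exact Finset.disjoint_left.1 hXZ hu hw)
  have hT' : G.singletonSubgraph v ⊔ fan v U T = B ⊔ fan v X T := by
    rw [← hun, fan_union, ← sup_assoc]
  have hfX := hf.mono hXU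
  have hlive : ∀ u ∈ X, ∃ W a, IsLive c S R h (T u) u W a := fun u hu =>
    (hU u (hXU hu)).resolve_left (Finset.mem_filter.1 hu).2
  choose! W a hlive using hlive
  rw [hT']
  by_cases hvR : v ∈ R
  · right
    refine ⟨nodePower c S v, ?_⟩
    have hvu : ∀ u, v ∈ (G.singletonSubgraph v ⊔ (link G v u ⊔ T u)).verts := fun u => .inl rfl
    have hvT : v ∈ (B ⊔ fan v (∅ ∪ X) T).verts := .inl hv
    have := isLive_of_fan (B := B) (D := ∅) (Y := X) (T := T) (W := W) (a := a) (W' := nodePower c S v)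
      (ω := 0) (κ := 0) hh
      (by rwa [Finset.empty_union]) (by simp) (Finset.disjoint_empty_left _) hBc hBS hv hBR
      (by rwa [Finset.empty_union]) (by rwa [Finset.empty_union])
      (fun u hu => hasConnector_of_mem hvR (hvu u) _ _)
      (hasConnector_of_mem hvR hvT _ _) zero_le (by simp)
      ⟨G.singletonSubgraph v, SimpleGraph.Subgraph.singletonSubgraph_connected,
        (SimpleGraph.singletonSubgraph_le_iff v _).2 hvT, rfl, ⟨v, by simpa using hvR⟩,
        (powerOn_singleton v).le⟩
    rwa [Finset.empty_union] at this
  have hBR' : R ∩ B.verts = ∅ :=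
    Set.eq_empty_of_forall_notMem fun x hx => hvR ((hBR hx : x = v) ▸ hx.1)
  rcases X.eq_empty_or_nonempty with hX0 | ⟨L, hL⟩
  · left
    rw [hX0, fan_empty, sup_bot_eq, hBR']
  right
  have hone := isLive_of_single (B := G.singletonSubgraph v) (hfX.adj L hL) (hfX.le L hL)
    (hfX.root_mem L hL) (hfX.notMem L hL) SimpleGraph.Subgraph.singletonSubgraph_connected
    ((SimpleGraph.singletonSubgraph_le_iff v S).2 hvS) rfl hvR
    (Set.eq_empty_of_forall_notMem fun x hx => hvR ((hx.2 : x = v) ▸ hx.1))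
    (Set.disjoint_singleton_left.2 (hfX.notMem L hL)) (hlive L hL)
  rcases (X.erase L).eq_empty_or_nonempty with hX1 | ⟨y, hy⟩
  · have hXL : X = {L} := by
      rw [← Finset.insert_erase hL, hX1]
      rfl
    have e : fan v X T = link G v L ⊔ T L := by rw [hXL]; exact Finset.sup_singleton
    rw [e]
    exact ⟨_, _, isLive_of_single (hfX.adj L hL) (hfX.le L hL) (hfX.root_mem L hL)
      (hfX.notMem L hL) hBc hBS hv hvR hBR' (hBX L hL) (hlive L hL)⟩
  · have hXL : {L} ∪ X.erase L = X := by
      rw [← Finset.insert_eq, Finset.insert_erase hL]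
    refine ⟨nodePower c S v + W L, ?_⟩
    have hvB := (SimpleGraph.singletonSubgraph_le_iff v B).2 hv
    have hyX := Finset.mem_of_mem_erase hy
    have hconn : ∀ u ∈ X, HasConnector c R v (G.singletonSubgraph v ⊔ (link G v u ⊔ T u))
        (c s(v, u)) (W u) := fun u hu =>
      (hlive u hu).hasConnector (hfX.le u hu) (hfX.adj u hu) (hfX.notMem u hu) hvR
    obtain ⟨P, hP, hPT, hPv, hPR, hPW⟩ := hone.connector
    have := isLive_of_fan (B := B) (D := {L}) (Y := X.erase L) (W' := nodePower c S v + W L)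
      (T := T) (W := W) (a := a) (ω := c s(v, y)) (κ := W y) hh (by rwa [hXL]) (by simp) (by simp) hBc hBS hv
      hBR (by rwa [hXL]) (by rwa [hXL]) (fun u hu => hconn u (Finset.mem_of_mem_erase hu))
      (by
        rw [hXL]
        exact (hconn y hyX).mono (sup_le_sup hvB (le_fan T hyX)))
      (Finset.single_le_sum (f := W) (fun _ _ => zero_le) hy) (by simp)
      (by
        rw [hXL]
        exact ⟨P, hP, hPT.trans (sup_le_sup hvB (le_fan T hL)), hPv, hPR, hPW⟩)
    rwa [hXL] at this

end MinPower

namespace MinPower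

variable {V : Type*} {G : SimpleGraph V}

/-! ### Rooting the Steiner tree -/

/-- A tree has a depth function for every choice of a root: adjacent nodes have consecutive depths,
and every node but the root has exactly one neighbor of smaller depth, its parent. -/
lemma exists_depth {S : G.Subgraph} (hS : S.coe.IsTree) (r : S.verts) :
    ∃ d : V → ℕ, (∀ x y, S.Adj x y → d x = d y + 1 ∨ d y = d x + 1) ∧
      (∀ x y z, S.Adj x y → S.Adj x z → d x = d y + 1 → d x = d z + 1 → y = z) ∧
      ∀ x ∈ S.verts, x ≠ r → ∃ y, S.Adj x y ∧ d x = d y + 1 := by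
  classical
  let d : V → ℕ := fun x => if hx : x ∈ S.verts then S.coe.dist r ⟨x, hx⟩ else 0
  have hd : ∀ x : S.verts, d x = S.coe.dist r x := fun x => dif_pos x.2
  have h1 : ∀ x y, S.Adj x y → d x = d y + 1 ∨ d y = d x + 1 := fun x y hxy => by
    rw [hd ⟨x, hxy.fst_mem⟩, hd ⟨y, hxy.snd_mem⟩]
    exact hS.dist_eq_dist_add_one_of_adj r hxy.coe
  refine ⟨d, h1, ?_, ?_⟩
  · intro x y z hy hz hdy hdz
    rw [hd ⟨x, hy.fst_mem⟩, hd ⟨y, hy.snd_mem⟩] at hdy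
    rw [hd ⟨x, hz.fst_mem⟩, hd ⟨z, hz.snd_mem⟩] at hdz
    obtain ⟨p, hp⟩ := hS.connected.exists_walk_length_eq_dist r ⟨y, hy.snd_mem⟩
    obtain ⟨q, hq⟩ := hS.connected.exists_walk_length_eq_dist r ⟨z, hz.snd_mem⟩
    have hp' := (p.concat hy.symm.coe).isPath_of_length_eq_dist
      (by rw [SimpleGraph.Walk.length_concat, hp, hdy])
    have hq' := (q.concat hz.symm.coe).isPath_of_length_eq_dist
      (by rw [SimpleGraph.Walk.length_concat, hq, hdz])
    have := (hS.existsUnique_path r ⟨x, hy.fst_mem⟩).unique hp' hq'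
    have := congrArg SimpleGraph.Walk.penultimate this
    rw [SimpleGraph.Walk.penultimate_concat, SimpleGraph.Walk.penultimate_concat] at this
    exact congrArg Subtype.val this
  · intro x hx hxr
    obtain ⟨p, hp⟩ := hS.connected.exists_walk_length_eq_dist ⟨x, hx⟩ r
    cases p with
    | nil => exact (hxr rfl).elim
    | @cons _ y _ hxy q =>
      have hxy' : S.Adj x y := hxy
      refine ⟨y, hxy', (h1 x y hxy').resolve_right fun h => ?_⟩
      have h2 := SimpleGraph.dist_le q
      have h3 := SimpleGraph.dist_comm (G := S.coe) (u := r) (v := ⟨x, hx⟩)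
      have h4 := SimpleGraph.dist_comm (G := S.coe) (u := r) (v := y)
      rw [hd ⟨x, hx⟩, hd y] at h
      rw [SimpleGraph.Walk.length_cons] at hp
      omega

/-- The descendants of `v` in `S` with respect to the depth function `d`. -/
def descendants (S : G.Subgraph) (d : V → ℕ) (v : V) : Set V :=
  {x | Relation.ReflTransGen (fun a b => S.Adj a b ∧ d b = d a + 1) v x}

/-- The part of `S` below `v`. -/
def branch (S : G.Subgraph) (d : V → ℕ) (v : V) : G.Subgraph := S.induce (descendants S d v)

open Classical in
/-- The children of `v` in `S` with respect to the depth function `d`. -/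
noncomputable def children [Fintype V] (S : G.Subgraph) (d : V → ℕ) (v : V) : Finset V :=
  Finset.univ.filter fun u => S.Adj v u ∧ d u = d v + 1

variable {S : G.Subgraph} {d : V → ℕ}

lemma mem_children [Fintype V] {v u : V} :
    u ∈ children S d v ↔ S.Adj v u ∧ d u = d v + 1 := by
  classical
  simp [children]

lemma mem_descendants_iff [Fintype V] {v x : V} :
    x ∈ descendants S d v ↔ x = v ∨ ∃ u ∈ children S d v, x ∈ descendants S d u := by
  rw [descendants, Set.mem_ofPred_eq, Relation.ReflTransGen.cases_head_iff, eq_comm (a := v)]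
  simp only [mem_children]
  rfl

lemma le_of_mem_descendants {v x : V} (h : x ∈ descendants S d v) : d v ≤ d x := by
  change Relation.ReflTransGen _ v x at h
  induction h with
  | refl => exact le_rfl
  | tail _ hbc ih =>
    have := hbc.2
    omega

lemma mem_verts_of_mem_descendants {v x : V} (hv : v ∈ S.verts) (h : x ∈ descendants S d v) :
    x ∈ S.verts := by
  change Relation.ReflTransGen _ v x at h
  induction h with
  | refl => exact hv
  | tail _ hbc => exact hbc.1.snd_mem

lemma self_mem_descendants (v : V) : v ∈ descendants S d v := Relation.ReflTransGen.refl

lemma isFan_branch [Fintype V]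
    (hd : ∀ x y z, S.Adj x y → S.Adj x z → d x = d y + 1 → d x = d z + 1 → y = z) (v : V) :
    IsFan S v (children S d v) (branch S d) where
  adj u hu := (mem_children.1 hu).1
  le u hu := ⟨fun _ hx => mem_verts_of_mem_descendants (mem_children.1 hu).1.snd_mem hx,
    fun _ _ hxy => hxy.2.2⟩
  root_mem u _ := self_mem_descendants u
  notMem u hu hv := by
    have h1 := le_of_mem_descendants hv
    have h2 := (mem_children.1 hu).2
    omega
  disjoint u hu w hw huw := by
    rw [Set.disjoint_left]
    intro x hx hx'
    have hu' := (mem_children.1 hu).2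
    have hw' := (mem_children.1 hw).2
    -- the ancestors of `x` form a chain
    have key := Relation.ReflTransGen.total_of_right_unique
      (r := Function.swap fun a b => S.Adj a b ∧ d b = d a + 1)
      (fun a b e hb he => hd a b e hb.1.symm he.1.symm hb.2 he.2)
      (Relation.reflTransGen_swap.2 hx) (Relation.reflTransGen_swap.2 hx')
    rcases key with key | key
    · rcases Relation.ReflTransGen.cases_head (Relation.reflTransGen_swap.1 key) with
        h | ⟨y, hy, hyx⟩
      · exact huw h.symm
      · have := le_of_mem_descendants (S := S) (d := d) hyx
        omega
    · rcases Relation.ReflTransGen.cases_head (Relation.reflTransGen_swap.1 key) with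
        h | ⟨y, hy, hyx⟩
      · exact huw h
      · have := le_of_mem_descendants (S := S) (d := d) hyx
        omega

lemma branch_eq [Fintype V] (hd : ∀ x y, S.Adj x y → d x = d y + 1 ∨ d y = d x + 1) (v : V) :
    branch S d v = G.singletonSubgraph v ⊔ fan v (children S d v) (branch S d) := by
  have key : ∀ x y, x ∈ descendants S d v → S.Adj x y → d y = d x + 1 →
      ∃ u ∈ children S d v, (link G v u).Adj x y ∨ (branch S d u).Adj x y := by
    intro x y hx hxy hdy
    rcases mem_descendants_iff.1 hx with rfl | ⟨u, hu, hxu⟩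
    · exact ⟨y, mem_children.2 ⟨hxy, hdy⟩, .inl (link_adj.2 ⟨hxy.adj_sub, .inl ⟨rfl, rfl⟩⟩)⟩
    · exact ⟨u, hu, .inr ⟨hxu, Relation.ReflTransGen.tail hxu ⟨hxy, hdy⟩, hxy⟩⟩
  ext x y
  · simp only [SimpleGraph.Subgraph.verts_sup, Set.mem_union, mem_fan]
    constructor
    · intro hx
      rcases mem_descendants_iff.1 hx with rfl | ⟨u, hu, hxu⟩
      · exact .inl rfl
      · exact .inr ⟨u, hu, .inr hxu⟩
    · rintro (rfl | ⟨u, hu, (rfl | rfl) | hx⟩)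
      · exact self_mem_descendants _
      · exact self_mem_descendants _
      · exact mem_descendants_iff.2 (.inr ⟨_, hu, self_mem_descendants _⟩)
      · exact mem_descendants_iff.2 (.inr ⟨u, hu, hx⟩)
  · rw [SimpleGraph.Subgraph.sup_adj, fan_adj]
    constructor
    · rintro ⟨hx, hy, hxy⟩
      right
      rcases hd x y hxy with h | h
      · obtain ⟨u, hu, h⟩ := key y x hy hxy.symm h
        exact ⟨u, hu, h.imp (fun h => h.symm) fun h => h.symm⟩
      · exact key x y hx hxy h
    · rintro (h | ⟨u, hu, h | h⟩)
      · exact h.elim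
      · have hu' := (mem_children.1 hu).1
        have hmem := mem_descendants_iff.2 (.inr ⟨u, hu, self_mem_descendants u⟩)
        rcases (link_adj.1 h).2 with ⟨rfl, rfl⟩ | ⟨rfl, rfl⟩
        · exact ⟨self_mem_descendants _, hmem, hu'⟩
        · exact ⟨hmem, self_mem_descendants _, hu'.symm⟩
      · exact ⟨mem_descendants_iff.2 (.inr ⟨u, hu, h.1⟩),
          mem_descendants_iff.2 (.inr ⟨u, hu, h.2.1⟩), h.2.2⟩

lemma branch_root {r : V}
    (hr : r ∈ S.verts) (hd : ∀ x ∈ S.verts, x ≠ r → ∃ y, S.Adj x y ∧ d x = d y + 1) :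
    branch S d r = S := by
  have : descendants S d r = S.verts := by
    refine Set.Subset.antisymm (fun x hx => mem_verts_of_mem_descendants hr hx) fun x hx => ?_
    induction hn : d x using Nat.strong_induction_on generalizing x with
    | h n ih =>
      by_cases hxr : x = r
      · exact hxr ▸ self_mem_descendants _
      · obtain ⟨y, hxy, hdy⟩ := hd x hx hxr
        exact Relation.ReflTransGen.tail (ih (d y) (by omega) y hxy.snd_mem rfl) ⟨hxy.symm, hdy⟩
  rw [branch, this, SimpleGraph.Subgraph.induce_self_verts]

lemma isTree_of_le {H : G.Subgraph} (hS : S.coe.IsTree) (hH : H.Connected) (h : H ≤ S) :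
    H.coe.IsTree :=
  ⟨hH.coe, hS.isAcyclic.comap (SimpleGraph.Subgraph.inclusion h)
    (SimpleGraph.Subgraph.inclusion.injective h)⟩

variable [Fintype V]

lemma branch_connected_and_live {c : Sym2 V → ℝ≥0} {R : Set V} {h : ℕ} (hh : 3 ≤ h)
    (hd₁ : ∀ x y, S.Adj x y → d x = d y + 1 ∨ d y = d x + 1)
    (hd₂ : ∀ x y z, S.Adj x y → S.Adj x z → d x = d y + 1 → d x = d z + 1 → y = z)
    (v : V) (hv : v ∈ S.verts) :
    (branch S d v).Connected ∧ (R ∩ (branch S d v).verts = ∅ ∨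
      ∃ W a, IsLive c S R h (branch S d v) v W a) := by
  have hM : ∀ x, d x ≤ Finset.univ.sup d := fun x => Finset.le_sup (Finset.mem_univ x)
  induction hn : Finset.univ.sup d - d v using Nat.strong_induction_on generalizing v with
  | h n ih =>
    have hfan := isFan_branch hd₂ v
    have h1 : ∀ u ∈ children S d v, (branch S d u).Connected ∧ (R ∩ (branch S d u).verts = ∅ ∨
        ∃ W a, IsLive c S R h (branch S d u) u W a) := fun u hu => by
      have hu' := mem_children.1 hu
      have := hM u
      exact ih (Finset.univ.sup d - d u) (by omega) u hu'.1.snd_mem rfl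
    rw [branch_eq hd₁ v]
    exact ⟨hfan.sup_fan_connected (fun u hu => (h1 u hu).1)
      SimpleGraph.Subgraph.singletonSubgraph_connected rfl,
      live_or_dead_step hh hv hfan (fun u hu => (h1 u hu).1) fun u hu => (h1 u hu).2⟩

end MinPower

theorem theorem2 {V : Type*} [Fintype V] (G : SimpleGraph V) (c : Sym2 V → ℝ≥0) (R : Set V)
    (S : G.Subgraph) (hS : MinPower.IsSteinerTree R S) (h : ℕ) (hh : 3 ≤ h) :
    ∃ (n : ℕ) (C : Fin n → G.Subgraph),
      MinPower.IsDecomposition R S (h ^ h) C ∧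
      ∑ i, MinPower.power c (C i) ≤ (1 + 14 / (h : ℝ≥0)) * MinPower.power c S := by
  obtain ⟨r⟩ := hS.isTree.connected.nonempty
  obtain ⟨d, hd₁, hd₂, hd₃⟩ := MinPower.exists_depth hS.isTree r
  have key := (MinPower.branch_connected_and_live (c := c) (R := R) hh hd₁ hd₂ r r.2).2
  rw [MinPower.branch_root r.2 hd₃, Set.inter_eq_left.2 hS.terminals_subset] at key
  rcases key with rfl | ⟨W, a, hlive⟩
  · refine ⟨1, fun _ => S, ⟨fun _ => le_rfl, fun _ => hS.isTree, fun _ => by simp, by simp,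
      MinPower.componentGraph_isTree_of_unique (Set.empty_subset _)⟩, ?_⟩
    rw [Fin.sum_univ_one]
    exact le_mul_of_one_le_left zero_le (le_add_of_nonneg_right zero_le)
  -- some number of levels at the root is at most as expensive as the average
  have hpos : (h : ℝ≥0) ≠ 0 := by
    have : h ≠ 0 := by omega
    exact_mod_cast this
  obtain ⟨l, hl, hcost⟩ : ∃ l ∈ Finset.range h,
      a l + MinPower.nodePower c S r ≤ (1 + 8 / (h : ℝ≥0)) * MinPower.power c S := by
    refine Finset.exists_le_of_sum_le (Finset.nonempty_range_iff.2 (by omega)) ?_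
    rw [Finset.sum_add_distrib, Finset.sum_const, Finset.sum_const, Finset.card_range,
      nsmul_eq_mul, nsmul_eq_mul]
    refine (le_self_add.trans hlive.budget).trans (le_of_eq ?_)
    rw [MinPower.powerOn_self]
    field_simp
  have hl := Finset.mem_range.1 hl
  obtain ⟨ι, _, C, hC⟩ := hlive.dec l hl
  rw [Set.inter_eq_left.2 hS.terminals_subset] at hC
  let e := (Fintype.equivFin (Option ι)).symm
  refine ⟨Fintype.card (Option ι), C ∘ e, ⟨fun i => hC.le _, fun i =>
    MinPower.isTree_of_le hS.isTree (hC.connected _) (hC.le _), fun i => ?_, ?_,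
    MinPower.componentGraph_comp_equiv_isTree e hC.tree⟩, ?_⟩
  · rw [Function.comp_apply]
    rcases e i with _ | j
    · exact hC.card_root_le.trans (Nat.pow_le_pow_right (by omega) hl.le)
    · exact hC.card_le j
  · rw [← hC.span]
    exact e.surjective.iSup_comp C
  · have hsum : ∑ i, MinPower.power c ((C ∘ e) i) = ∑ i, MinPower.power c (C i) :=
      e.sum_comp fun i => MinPower.power c (C i)
    rw [hsum, Fintype.sum_option, MinPower.power_eq_add_outerPower c (C none) r]
    have h1 := MinPower.nodePower_mono c (hC.le none) r
    calc _ = (∑ i, MinPower.power c (C (some i)) + MinPower.outerPower c (C none) r) +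
          MinPower.nodePower c (C none) r := by ring
      _ ≤ a l + MinPower.nodePower c S r := add_le_add hC.cost_le h1
      _ ≤ (1 + 8 / (h : ℝ≥0)) * MinPower.power c S := hcost
      _ ≤ _ := by gcongr; norm_num
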